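/- Setting. Let $\mathcal X_1,\mathcal X_2,\mathcal Y,\mathcal A,\hat{\mathcal X}_1,\hat{\mathcal X}_2$ be finite alphabets, $p(x_1,x_2)$ a pmf on $\mathcal X_1\times\mathcal X_2$, $p(y|a,x_1,x_2)$ a conditional pmf, $\Lambda:\mathcal A\to[0,\infty)$ an action cost and $d_j:\mathcal X_1\times\mathcal X_2\times\mathcal Y\times\hat{\mathcal X}_j\to[0,\infty)$, $j=1,2$, distortion measures. The pairs $(X_{1i},X_{2i})$, $i=1,\dots,n$, are i.i.d. with pmf $p(x_1,x_2)$. An $(n,R_{12},R_{23},D_1,D_2,\Gamma)$ code for the cascade network consists of an encoder $g_1:\mathcal X_1^n\times\mathcal X_2^n\to[1,2^{nR_{12}}]$ (giving the message $M_{12}=g_1(X_1^n,X_2^n)$ from Node 1 to Node 2), an encoder $g_2:\mathcal X_2^n\times[1,2^{nR_{12}}]\to[1,2^{nR_{23}}]$ (giving the message $M_{23}=g_2(X_2^n,M_{12})$ from Node 2 to Node 3), an action function $\ell:[1,2^{nR_{23}}]\to\mathcal A^n$ (with $A^n=\ell(M_{23})$), a decoder $h_1:[1,2^{nR_{12}}]\times\mathcal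 X_2^n\to\hat{\mathcal X}_1^n$ at Node 2 (with $\hat X_1^n=h_1(M_{12},X_2^n)$) and causal decoders $h_{2i}:[1,2^{nR_{23}}]\times\mathcal Y^i\to\hat{\mathcal X}_2$ at Node 3 (with $\hat X_{2i}=h_{2i}(M_{23},Y^i)$), $1\le i\le n$, where $[1,2^{nR}]$ is the set of integers between $1$ and $2^{nR}$ and, given $(A^n,X_1^n,X_2^n)$, the sequence $Y^n$ has pmf $\prod_{i=1}^n p(y_i|a_i,x_{1i},x_{2i})$; it is required that $\frac1n\sum_{i=1}^n E[\Lambda(A_i)]\le\Gamma$ and $\frac1n\sum_{i=1}^n E[d_j(X_{1i},X_{2i},Y_i,\hat X_{ji})]\le D_j$ for $j=1,2$. A pair $(R_{12},R_{23})$ is achievable for $(D_1,D_2,\Gamma)$ if for every $\epsilon>0$ and all sufficiently large $n$ there is an $(n,R_{12},R_{23},D_1+\epsilon,D_2+\epsilon,\Gamma+\epsilon)$ code. The rate-distortion-cost region $\mathcal R(D_1,D_2,\Gamma)$ is the closure of the set of achievable pairs. Proposition. For all real $D_1,D_2,\Gamma$, the region $\mathcal R(D_1,D_2,\Gamma)$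 is the set of all pairs $(R_{12},R_{23})$ with $$R_{12}\ge I(X_1;U,A,\hat X_1|X_2),\qquad R_{23}\ge I(X_1,X_2;U,A)$$ (information in bits) for some finite auxiliary alphabet $\mathcal U$, some conditional pmf $p(a,u,\hat x_1|x_1,x_2)$ and some function $\hat{\mathrm x}_2:\mathcal U\times\mathcal Y\to\hat{\mathcal X}_2$, where $(X_1,X_2,A,U,\hat X_1,Y)$ has joint pmf $p(x_1,x_2)\,p(a,u,\hat x_1|x_1,x_2)\,p(y|a,x_1,x_2)$ and $\hat X_2=\hat{\mathrm x}_2(U,Y)$, such that $E[\Lambda(A)]\le\Gamma$ and $E[d_j(X_1,X_2,Y,\hat X_j)]\le D_j$ for $j=1,2$. Moreover, the region $\mathcal R(D_1,D_2,\Gamma)$ is unchanged in this description if $\mathcal U$ is restricted to satisfy $|\mathcal U|\le|\mathcal X_1||\mathcal X_2|+4$. -/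

import Mathlib

/-! ### Finite probability and information measures (in bits) -/

section Information

variable {Ω α β γ : Type*} [Fintype Ω] [Fintype α] [Fintype β] [Fintype γ]

/-- Probability mass function of the random variable `X` when outcomes have pmf `p`. -/
noncomputable def lawOf (p : Ω → ℝ) (X : Ω → α) (a : α) : ℝ :=
  ∑ ω, Set.indicator (X ⁻¹' {a}) p ω

/-- Expectation of the real random variable `f`. -/
noncomputable def expect (p : Ω → ℝ) (f : Ω → ℝ) : ℝ :=
  ∑ ω, p ω * f ω

/-- Entropy `H(X) = -∑ p(x) log₂ p(x)`. -/
noncomputable def entropy (p : Ω → ℝ) (X : Ω → α) : ℝ :=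
  -∑ a, lawOf p X a * Real.logb 2 (lawOf p X a)

/-- Conditional entropy `H(X|Z) = -∑ p(x,z) log₂ (p(x,z) / p(z))`. -/
noncomputable def condEntropy (p : Ω → ℝ) (X : Ω → α) (Z : Ω → γ) : ℝ :=
  -∑ a, ∑ c, lawOf p (fun ω => (X ω, Z ω)) (a, c) *
    Real.logb 2 (lawOf p (fun ω => (X ω, Z ω)) (a, c) / lawOf p Z c)

/-- Mutual information `I(X;Y) = H(X) - H(X|Y)`. -/
noncomputable def mutualInfo (p : Ω → ℝ) (X : Ω → α) (Y : Ω → β) : ℝ :=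
  entropy p X - condEntropy p X Y

/-- Conditional mutual information `I(X;Y|Z) = H(X|Z) - H(X|Y,Z)`. -/
noncomputable def condMutualInfo (p : Ω → ℝ) (X : Ω → α) (Y : Ω → β) (Z : Ω → γ) : ℝ :=
  condEntropy p X Z - condEntropy p X (fun ω => (Y ω, Z ω))

end Information

/-- Data of the cascade problem: the source pmf `p(x₁,x₂)`, the channel `p(y|a,x₁,x₂)` of the
side-information vending machine, the action cost and the two distortion measures.
(Bounds on the cost and on the distortions are automatic, all alphabets being finite.) -/
structure CascadeModel (X₁ X₂ Y A Xh₁ Xh₂ : Type*) [Fintype X₁] [Fintype X₂] [Fintype Y] where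
  /-- joint pmf of `(X₁, X₂)` -/
  src : X₁ × X₂ → ℝ
  src_mem : src ∈ stdSimplex ℝ (X₁ × X₂)
  /-- `chan a x₁ x₂ y` is `p(y|a,x₁,x₂)` -/
  chan : A → X₁ → X₂ → Y → ℝ
  chan_mem : ∀ a x₁ x₂, chan a x₁ x₂ ∈ stdSimplex ℝ Y
  /-- action cost -/
  cost : A → ℝ
  cost_nonneg : ∀ a, 0 ≤ cost a
  /-- distortion at Node 2 -/
  d₁ : X₁ → X₂ → Y → Xh₁ → ℝ
  d₁_nonneg : ∀ x₁ x₂ y z, 0 ≤ d₁ x₁ x₂ y z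
  /-- distortion at Node 3 -/
  d₂ : X₁ → X₂ → Y → Xh₂ → ℝ
  d₂_nonneg : ∀ x₁ x₂ y z, 0 ≤ d₂ x₁ x₂ y z

/-- Number of integers in `[1, 2^{nR}]`. -/
noncomputable def msgCount (n : ℕ) (R : ℝ) : ℕ :=
  ⌊(2 : ℝ) ^ ((n : ℝ) * R)⌋₊

/-- The encoders, action function and decoders of a length-`n` code with rates `R₁₂`, `R₂₃`.
Indices `i : Fin n` start from `0`, so the decoder of symbol `i` of Node 3 sees the first `i + 1`
side-information symbols, the current one included. -/
structure CascadeCode (X₁ X₂ Y A Xh₁ Xh₂ : Type*) (n : ℕ) (R₁₂ R₂₃ : ℝ) where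
  /-- encoder of Node 1 -/
  g₁ : (Fin n → X₁) → (Fin n → X₂) → Fin (msgCount n R₁₂)
  /-- encoder of Node 2 -/
  g₂ : (Fin n → X₂) → Fin (msgCount n R₁₂) → Fin (msgCount n R₂₃)
  /-- action function of Node 3 -/
  act : Fin (msgCount n R₂₃) → Fin n → A
  /-- decoder of Node 2 -/
  h₁ : Fin (msgCount n R₁₂) → (Fin n → X₂) → Fin n → Xh₁
  /-- causal decoders of Node 3 -/
  h₂ : (i : Fin n) → Fin (msgCount n R₂₃) → (Fin (i.val + 1) → Y) → Xh₂

namespace CascadeCode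

variable {X₁ X₂ Y A Xh₁ Xh₂ : Type*} {n : ℕ} {R₁₂ R₂₃ : ℝ}

/-- Message from Node 1 to Node 2. -/
def msg₁₂ (c : CascadeCode X₁ X₂ Y A Xh₁ Xh₂ n R₁₂ R₂₃) (x₁ : Fin n → X₁) (x₂ : Fin n → X₂) :
    Fin (msgCount n R₁₂) :=
  c.g₁ x₁ x₂

/-- Message from Node 2 to Node 3. -/
def msg₂₃ (c : CascadeCode X₁ X₂ Y A Xh₁ Xh₂ n R₁₂ R₂₃) (x₁ : Fin n → X₁) (x₂ : Fin n → X₂) :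
    Fin (msgCount n R₂₃) :=
  c.g₂ x₂ (c.msg₁₂ x₁ x₂)

/-- Action sequence. -/
def action (c : CascadeCode X₁ X₂ Y A Xh₁ Xh₂ n R₁₂ R₂₃) (x₁ : Fin n → X₁) (x₂ : Fin n → X₂) :
    Fin n → A :=
  c.act (c.msg₂₃ x₁ x₂)

/-- Estimate at Node 2. -/
def est₁ (c : CascadeCode X₁ X₂ Y A Xh₁ Xh₂ n R₁₂ R₂₃) (x₁ : Fin n → X₁) (x₂ : Fin n → X₂) :
    Fin n → Xh₁ :=
  c.h₁ (c.msg₁₂ x₁ x₂) x₂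

/-- Estimate at Node 3, from the message and the side information received so far. -/
def est₂ (c : CascadeCode X₁ X₂ Y A Xh₁ Xh₂ n R₁₂ R₂₃) (x₁ : Fin n → X₁) (x₂ : Fin n → X₂)
    (y : Fin n → Y) (i : Fin n) : Xh₂ :=
  c.h₂ i (c.msg₂₃ x₁ x₂) (fun j => y (Fin.castLE i.isLt j))

end CascadeCode

/-- A single-letter choice with auxiliary alphabet `U`: a conditional pmf `p(a,u,x̂₁|x₁,x₂)` and
a deterministic function `x̂₂(u,y)`. -/
structure TestChannel (X₁ X₂ Y A Xh₁ Xh₂ U : Type*) [Fintype A] [Fintype Xh₁] [Fintype U] where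
  /-- `q x₁ x₂ (a, u, x̂₁)` is `p(a,u,x̂₁|x₁,x₂)` -/
  q : X₁ → X₂ → A × U × Xh₁ → ℝ
  q_mem : ∀ x₁ x₂, q x₁ x₂ ∈ stdSimplex ℝ (A × U × Xh₁)
  /-- the function `x̂₂(u,y)` -/
  xhat₂ : U → Y → Xh₂

namespace CascadeModel

variable {X₁ X₂ Y A Xh₁ Xh₂ : Type*} [Fintype X₁] [Fintype X₂] [Fintype Y] [Fintype A]
  [Fintype Xh₁]

/-- Joint pmf of `(X₁ⁿ, X₂ⁿ, Yⁿ)` under a code: an i.i.d. source, and a memoryless channel driven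
by the action sequence and the sources. -/
noncomputable def blockPmf (M : CascadeModel X₁ X₂ Y A Xh₁ Xh₂) {n : ℕ} {R₁₂ R₂₃ : ℝ}
    (c : CascadeCode X₁ X₂ Y A Xh₁ Xh₂ n R₁₂ R₂₃) :
    (Fin n → X₁) × (Fin n → X₂) × (Fin n → Y) → ℝ :=
  fun (x₁, x₂, y) =>
    (∏ i, M.src (x₁ i, x₂ i)) * ∏ i, M.chan (c.action x₁ x₂ i) (x₁ i) (x₂ i) (y i)

/-- The code meets the average action cost `Γ` and the average distortions `D₁`, `D₂`. -/
def Meets (M : CascadeModel X₁ X₂ Y A Xh₁ Xh₂) {n : ℕ} {R₁₂ R₂₃ : ℝ}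
    (c : CascadeCode X₁ X₂ Y A Xh₁ Xh₂ n R₁₂ R₂₃) (D₁ D₂ Γ : ℝ) : Prop :=
  (1 / (n : ℝ)) * ∑ i, expect (M.blockPmf c)
      (fun (x₁, x₂, _) => M.cost (c.action x₁ x₂ i)) ≤ Γ ∧
  (1 / (n : ℝ)) * ∑ i, expect (M.blockPmf c)
      (fun (x₁, x₂, y) => M.d₁ (x₁ i) (x₂ i) (y i) (c.est₁ x₁ x₂ i)) ≤ D₁ ∧
  (1 / (n : ℝ)) * ∑ i, expect (M.blockPmf c)
      (fun (x₁, x₂, y) => M.d₂ (x₁ i) (x₂ i) (y i) (c.est₂ x₁ x₂ y i)) ≤ D₂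

/-- Achievability of the rate pair `R = (R₁₂, R₂₃)` for the distortion-cost tuple. -/
def Achievable (M : CascadeModel X₁ X₂ Y A Xh₁ Xh₂) (D₁ D₂ Γ : ℝ) (R : ℝ × ℝ) : Prop :=
  ∀ ε : ℝ, 0 < ε → ∃ N : ℕ, ∀ n : ℕ, N ≤ n →
    ∃ c : CascadeCode X₁ X₂ Y A Xh₁ Xh₂ n R.1 R.2, M.Meets c (D₁ + ε) (D₂ + ε) (Γ + ε)

/-- The rate-distortion-cost region. -/
def region (M : CascadeModel X₁ X₂ Y A Xh₁ Xh₂) (D₁ D₂ Γ : ℝ) : Set (ℝ × ℝ) :=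
  closure {R | M.Achievable D₁ D₂ Γ R}

variable {U : Type*} [Fintype U]

/-- The joint pmf `p(x₁,x₂) p(a,u,x̂₁|x₁,x₂) p(y|a,x₁,x₂)` of `(X₁, X₂, A, U, X̂₁, Y)`; the
variable `X̂₂` is the function `x̂₂(U,Y)` of these. -/
noncomputable def joint (M : CascadeModel X₁ X₂ Y A Xh₁ Xh₂)
    (T : TestChannel X₁ X₂ Y A Xh₁ Xh₂ U) : X₁ × X₂ × A × U × Xh₁ × Y → ℝ :=
  fun (x₁, x₂, a, u, z, y) => M.src (x₁, x₂) * T.q x₁ x₂ (a, u, z) * M.chan a x₁ x₂ y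

/-- The action cost and distortion constraints of the single-letter problem. -/
def Feasible (M : CascadeModel X₁ X₂ Y A Xh₁ Xh₂)
    (T : TestChannel X₁ X₂ Y A Xh₁ Xh₂ U) (D₁ D₂ Γ : ℝ) : Prop :=
  expect (M.joint T) (fun (_, _, a, _, _, _) => M.cost a) ≤ Γ ∧
  expect (M.joint T) (fun (x₁, x₂, _, _, z, y) => M.d₁ x₁ x₂ y z) ≤ D₁ ∧
  expect (M.joint T) (fun (x₁, x₂, _, u, _, y) => M.d₂ x₁ x₂ y (T.xhat₂ u y)) ≤ D₂

/-- `I(X₁; U, A, X̂₁ | X₂)`. -/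
noncomputable def info₁₂ (M : CascadeModel X₁ X₂ Y A Xh₁ Xh₂)
    (T : TestChannel X₁ X₂ Y A Xh₁ Xh₂ U) : ℝ :=
  condMutualInfo (M.joint T) (fun (x₁, _, _, _, _, _) => x₁)
    (fun (_, _, a, u, z, _) => (u, a, z)) (fun (_, x₂, _, _, _, _) => x₂)

/-- `I(X₁, X₂; U, A)`. -/
noncomputable def info₂₃ (M : CascadeModel X₁ X₂ Y A Xh₁ Xh₂)
    (T : TestChannel X₁ X₂ Y A Xh₁ Xh₂ U) : ℝ :=
  mutualInfo (M.joint T) (fun (x₁, x₂, _, _, _, _) => (x₁, x₂))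
    (fun (_, _, a, u, _, _) => (u, a))

end CascadeModel

/-! The theorem follows from two inclusions. The region lies in the single-letter set with bounded
auxiliary alphabet (`exists_testChannel_of_mem_region`), and every single-letter point, whatever its
alphabet, lies in the region (`mem_region_of_testChannel`). Hence the region, the bounded set and
the unbounded set coincide.

Converse. For a code of length n, let I be a uniform time and U = (I, M₂₃, X₁^{I-1}, X₂^{I-1}). Then
A is a function of U, and the chain rule gives ∑ H(X_{1i},X_{2i} | M₂₃, past) = H(X₁ⁿ,X₂ⁿ) - H(M₂₃),
which yields R₂₃. Conditioning on (M₁₂, X₂ⁿ, past) instead, and using H(M₁₂ | X₂ⁿ) ≤ nR₁₂, yields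
R₁₂. The estimate at Node 3 also uses past outputs, which U does not contain. The channel is driven
by noise tables independent of the sources, and some fixed tables do no worse than average, so the
past outputs become a function of U (`exists_pastRule`). Next |U| is bounded by a Carathéodory
argument (`exists_small_testChannel`). With |U| bounded, the conditional pmfs form finitely many
compact sets, so arbitrarily small slack can be removed (`exists_testChannel_of_forall_slack`); this
handles both the ε in achievability and the closure.

Achievability. Draw about 2^{nI(X₁,X₂;U,A)} codewords (Uⁿ,Aⁿ), so that one of them suits the source
block. Both Node 1 and Node 2 know X₂ⁿ, and only about 2^{nI(X₁;U,A|X₂)} codewords are compatible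
with it; Node 1 sends a position in that list, so no binning or decoding error arises. A second
index, of rate I(X₁;X̂₁|X₂,U,A), selects X̂₁ⁿ from a table attached to X₂ⁿ and the codeword. Node 2
forwards the codeword index, and Node 3 applies x̂₂(Uᵢ,Yᵢ). This is proved in one-shot form
(`exists_one_shot_code`), where typicality is replaced by upper bounds on empirical sums of
information densities, costs and distortions; the law of large numbers makes these bounds hold with
probability tending to 1 (`eventually_exists_block_code`). -/

section FiniteProbability

/-! ### Laws, entropies and their inequalities on finite probability spaces. -/

open scoped Classical
open Finset

variable {Ω α β γ : Type*} [Fintype Ω]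

theorem lawOf_eq_sum_ite [DecidableEq α] (p : Ω → ℝ) (X : Ω → α) (a : α) :
    lawOf p X a = ∑ ω, if X ω = a then p ω else 0 := by
  simp [lawOf, Set.indicator_apply]

theorem lawOf_id (p : Ω → ℝ) (ω : Ω) : lawOf p (fun ω => ω) ω = p ω := by
  simp [lawOf_eq_sum_ite]

theorem lawOf_nonneg {p : Ω → ℝ} (hp : ∀ ω, 0 ≤ p ω) (X : Ω → α) (a : α) : 0 ≤ lawOf p X a := by
  rw [lawOf_eq_sum_ite]
  exact sum_nonneg fun ω _ => by split_ifs <;> simp [hp]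

theorem le_lawOf {p : Ω → ℝ} (hp : ∀ ω, 0 ≤ p ω) (X : Ω → α) (ω : Ω) : p ω ≤ lawOf p X (X ω) := by
  rw [lawOf_eq_sum_ite]
  have := single_le_sum (f := fun ω' => if X ω' = X ω then p ω' else 0)
    (fun ω _ => by split_ifs <;> simp [hp]) (mem_univ ω)
  simpa using this

theorem lawOf_pos {p : Ω → ℝ} (hp : ∀ ω, 0 ≤ p ω) (X : Ω → α) {ω : Ω} (h : 0 < p ω) :
    0 < lawOf p X (X ω) :=
  h.trans_le (le_lawOf hp X ω)

/-- Only the fibre through ω matters. This lets tuples be reordered and redundant components dropped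
inside entropies by comparing fibres, with no explicit bijection of value types. -/
theorem lawOf_congr_ker (p : Ω → ℝ) {X : Ω → α} {Y : Ω → β} {ω : Ω}
    (h : ∀ ω', X ω' = X ω ↔ Y ω' = Y ω) : lawOf p X (X ω) = lawOf p Y (Y ω) := by
  simp_rw [lawOf_eq_sum_ite, h]

variable [Fintype α]

theorem sum_lawOf_mul (p : Ω → ℝ) (X : Ω → α) (f : α → ℝ) :
    ∑ a, lawOf p X a * f a = ∑ ω, p ω * f (X ω) := by
  simp_rw [lawOf_eq_sum_ite, sum_mul]
  rw [sum_comm]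
  refine sum_congr rfl fun ω _ => ?_
  simp [ite_mul]

theorem sum_lawOf (p : Ω → ℝ) (X : Ω → α) : ∑ a, lawOf p X a = ∑ ω, p ω := by
  simpa using sum_lawOf_mul p X (fun _ => 1)

theorem lawOf_comp (p : Ω → ℝ) (X : Ω → α) (g : α → β) :
    lawOf p (fun ω => g (X ω)) = lawOf (lawOf p X) g := by
  funext b
  rw [lawOf_eq_sum_ite, lawOf_eq_sum_ite]
  have := sum_lawOf_mul p X (fun a => if g a = b then 1 else 0)
  simp only [mul_ite, mul_one, mul_zero] at this
  exact this.symm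

theorem sum_lawOf_pair (p : Ω → ℝ) (X : Ω → α) (Z : Ω → β) (b : β) :
    ∑ a, lawOf p (fun ω => (X ω, Z ω)) (a, b) = lawOf p Z b := by
  simp_rw [lawOf_eq_sum_ite]
  rw [sum_comm]
  refine sum_congr rfl fun ω _ => ?_
  simp [Prod.ext_iff, ite_and]

variable [Fintype β] [Fintype γ]

theorem entropy_eq_expect (p : Ω → ℝ) (X : Ω → α) :
    entropy p X = -∑ ω, p ω * Real.logb 2 (lawOf p X (X ω)) := by
  rw [entropy, sum_lawOf_mul p X (fun a => Real.logb 2 (lawOf p X a))]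

theorem condEntropy_eq_expect (p : Ω → ℝ) (X : Ω → α) (Z : Ω → γ) :
    condEntropy p X Z = -∑ ω, p ω *
      Real.logb 2 (lawOf p (fun ω => (X ω, Z ω)) (X ω, Z ω) / lawOf p Z (Z ω)) := by
  rw [condEntropy, ← Fintype.sum_prod_type', ← sum_lawOf_mul p (fun ω => (X ω, Z ω))
    (fun w => Real.logb 2 (lawOf p (fun ω => (X ω, Z ω)) w / lawOf p Z w.2))]

theorem condEntropy_eq_sub {p : Ω → ℝ} (hp : ∀ ω, 0 ≤ p ω) (X : Ω → α) (Z : Ω → γ) :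
    condEntropy p X Z = entropy p (fun ω => (X ω, Z ω)) - entropy p Z := by
  rw [condEntropy_eq_expect, entropy_eq_expect, entropy_eq_expect, neg_sub_neg, ← sum_sub_distrib,
    ← sum_neg_distrib]
  refine sum_congr rfl fun ω _ => ?_
  rcases (hp ω).eq_or_lt with h | h
  · simp [← h]
  · rw [Real.logb_div (lawOf_pos hp _ h).ne' (lawOf_pos hp _ h).ne']
    ring

theorem entropy_congr_ker (p : Ω → ℝ) {X : Ω → α} {Y : Ω → β}
    (h : ∀ ω ω', X ω' = X ω ↔ Y ω' = Y ω) : entropy p X = entropy p Y := by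
  rw [entropy_eq_expect, entropy_eq_expect]
  simp_rw [fun ω => lawOf_congr_ker p (h ω)]

theorem entropy_comp (p : Ω → ℝ) (X : Ω → α) (g : α → β) :
    entropy p (fun ω => g (X ω)) = entropy (lawOf p X) g := by
  rw [entropy, entropy, lawOf_comp]

/-- Transports information quantities between probability spaces: from the block source or the full
joint law to the law of the few variables concerned. -/
theorem condEntropy_comp (p : Ω → ℝ) (V : Ω → α) (f : α → β) (g : α → γ) :
    condEntropy p (fun ω => f (V ω)) (fun ω => g (V ω)) = condEntropy (lawOf p V) f g := by
  rw [condEntropy, condEntropy, lawOf_comp p V g, lawOf_comp p V (fun a => (f a, g a))]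

theorem logTwo_pos : 0 < Real.log 2 := Real.log_pos one_lt_two

/-- `log₂ t ≤ (t - 1) / ln 2`. -/
theorem logb_two_le_sub_one {t : ℝ} (ht : 0 < t) : Real.logb 2 t ≤ (t - 1) / Real.log 2 := by
  rw [Real.logb]
  have := logTwo_pos
  gcongr
  exact Real.log_le_sub_one_of_pos ht

/-- Conditioning on more reduces the conditional entropy. -/
theorem condEntropy_le_comp {p : Ω → ℝ} (hp : ∀ ω, 0 ≤ p ω) (X : Ω → α) (Z : Ω → β) (f : β → γ) :
    condEntropy p X Z ≤ condEntropy p X (fun ω => f (Z ω)) := by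
  set A := lawOf p (fun ω => (X ω, Z ω)) with hA
  set B := lawOf p Z with hB
  set C := lawOf p (fun ω => (X ω, f (Z ω))) with hC
  set D := lawOf p (fun ω => f (Z ω)) with hD
  have hA0 : ∀ a, 0 ≤ A a := lawOf_nonneg hp _
  have hB0 : ∀ a, 0 ≤ B a := lawOf_nonneg hp _
  have hC0 : ∀ a, 0 ≤ C a := lawOf_nonneg hp _
  have hD0 : ∀ a, 0 ≤ D a := lawOf_nonneg hp _
  rw [condEntropy_eq_expect, condEntropy_eq_expect, ← sub_nonpos, neg_sub_neg, ← sum_sub_distrib]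
  -- The bound log₂ t ≤ (t - 1)/ln 2, applied to the ratio of the two conditional probabilities;
  -- points of zero mass contribute nothing.
  have h1 : ∀ ω, p ω * Real.logb 2 (C (X ω, f (Z ω)) / D (f (Z ω))) -
      p ω * Real.logb 2 (A (X ω, Z ω) / B (Z ω)) ≤
      (p ω * (C (X ω, f (Z ω)) * B (Z ω) / (D (f (Z ω)) * A (X ω, Z ω))) - p ω) / Real.log 2 := by
    intro ω
    rcases (hp ω).eq_or_lt with h | h
    · simp [← h]
    · have a0 : 0 < A (X ω, Z ω) := lawOf_pos hp (fun ω => (X ω, Z ω)) h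
      have b0 : 0 < B (Z ω) := lawOf_pos hp Z h
      have c0 : 0 < C (X ω, f (Z ω)) := lawOf_pos hp (fun ω => (X ω, f (Z ω))) h
      have d0 : 0 < D (f (Z ω)) := lawOf_pos hp (fun ω => f (Z ω)) h
      rw [← mul_sub, ← Real.logb_div (by positivity) (by positivity)]
      have := logb_two_le_sub_one (t := C (X ω, f (Z ω)) * B (Z ω) / (D (f (Z ω)) * A (X ω, Z ω)))
        (by positivity)
      have h2 : C (X ω, f (Z ω)) / D (f (Z ω)) / (A (X ω, Z ω) / B (Z ω)) =
        C (X ω, f (Z ω)) * B (Z ω) / (D (f (Z ω)) * A (X ω, Z ω)) := by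
        field_simp
      rw [h2]
      calc _ ≤ p ω * _ := mul_le_mul_of_nonneg_left this h.le
        _ = _ := by ring
  refine (sum_le_sum fun ω _ => h1 ω).trans ?_
  rw [← sum_div, sum_sub_distrib]
  refine div_nonpos_of_nonpos_of_nonneg (sub_nonpos.2 ?_) logTwo_pos.le
  rw [← sum_lawOf_mul p (fun ω => (X ω, Z ω))
    (fun w => C (w.1, f w.2) * B w.2 / (D (f w.2) * A w)), ← hA, Fintype.sum_prod_type, sum_comm,
    ← sum_lawOf p Z]
  refine sum_le_sum fun z _ => ?_
  -- Only an inequality: where A vanishes the left side is zero and the right side need not be.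
  have h3 : ∀ x, A (x, z) * (C (x, f z) * B z / (D (f z) * A (x, z))) ≤
      C (x, f z) * (B z / D (f z)) := by
    intro x
    rcases (hA0 (x, z)).eq_or_lt with h | h
    · rw [← h, zero_mul]
      exact mul_nonneg (hC0 _) (div_nonneg (hB0 _) (hD0 _))
    · apply le_of_eq
      field_simp
  refine (sum_le_sum fun x _ => h3 x).trans ?_
  rw [← sum_mul, sum_lawOf_pair p X (fun ω => f (Z ω)), ← hD, ← hB]
  rcases (hD0 (f z)).eq_or_lt with h | h
  · simp [← h, hB0]
  · exact (mul_div_cancel₀ _ h.ne').le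

theorem condEntropy_const {p : Ω → ℝ} (hp : ∀ ω, 0 ≤ p ω) (h1 : ∑ ω, p ω = 1) (X : Ω → α) :
    condEntropy p X (fun _ => ()) = entropy p X := by
  rw [condEntropy_eq_sub hp]
  have : entropy p (fun _ : Ω => ()) = 0 := by
    simp [entropy, lawOf_eq_sum_ite, h1]
  rw [this, sub_zero]
  exact entropy_congr_ker p fun ω ω' => by simp

theorem condEntropy_le_entropy {p : Ω → ℝ} (hp : ∀ ω, 0 ≤ p ω) (h1 : ∑ ω, p ω = 1) (X : Ω → α)
    (Z : Ω → β) : condEntropy p X Z ≤ entropy p X := by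
  rw [← condEntropy_const hp h1]
  exact condEntropy_le_comp hp X Z (fun _ => ())

theorem entropy_le_logb_card {p : Ω → ℝ} (hp : ∀ ω, 0 ≤ p ω) (h1 : ∑ ω, p ω = 1) (X : Ω → α) :
    entropy p X ≤ Real.logb 2 (Fintype.card α) := by
  have hne : Nonempty α := by
    by_contra h
    rw [not_nonempty_iff] at h
    have : IsEmpty Ω := ⟨fun ω => h.elim (X ω)⟩
    simp at h1
  have hm : (0 : ℝ) < Fintype.card α := by exact_mod_cast Fintype.card_pos
  have h2 : ∀ ω, p ω * -Real.logb 2 (lawOf p X (X ω)) - p ω * Real.logb 2 (Fintype.card α) ≤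
      (p ω * (lawOf p X (X ω) * Fintype.card α)⁻¹ - p ω) / Real.log 2 := by
    intro ω
    rcases (hp ω).eq_or_lt with h | h
    · simp [← h]
    · have a0 := lawOf_pos hp X h
      have := logb_two_le_sub_one (t := (lawOf p X (X ω) * Fintype.card α)⁻¹) (by positivity)
      rw [Real.logb_inv, Real.logb_mul a0.ne' hm.ne'] at this
      calc _ = p ω * -(Real.logb 2 (lawOf p X (X ω)) + Real.logb 2 (Fintype.card α)) := by ring
        _ ≤ p ω * _ := mul_le_mul_of_nonneg_left this h.le
        _ = _ := by ring
  have h3 := sum_le_sum fun ω (_ : ω ∈ univ) => h2 ω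
  rw [sum_sub_distrib, ← sum_mul, h1, one_mul, ← sum_div, sum_sub_distrib, h1,
    ← sum_lawOf_mul p X (fun a => (lawOf p X a * Fintype.card α)⁻¹)] at h3
  have h4 : ∑ a, lawOf p X a * (lawOf p X a * Fintype.card α)⁻¹ ≤ 1 := by
    calc _ ≤ ∑ a : α, (Fintype.card α : ℝ)⁻¹ := by
          refine sum_le_sum fun a _ => ?_
          rcases (lawOf_nonneg hp X a).eq_or_lt with h | h
          · simp [← h]
          · apply le_of_eq
            field_simp
      _ = 1 := by simp [hm.ne']
  have h5 : entropy p X = ∑ ω, p ω * -Real.logb 2 (lawOf p X (X ω)) := by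
    rw [entropy_eq_expect]; simp
  rw [h5]
  have : (∑ a, lawOf p X a * (lawOf p X a * Fintype.card α)⁻¹ - 1) / Real.log 2 ≤ 0 :=
    div_nonpos_of_nonpos_of_nonneg (by linarith) logTwo_pos.le
  linarith

end FiniteProbability

/-! ### Product pmfs: marginals, resampling of a coordinate, entropy. -/

section ProductPmf

open scoped Classical
open Finset

variable {ι : Type*} [Fintype ι] [DecidableEq ι]

theorem sum_prod_apply {β : ι → Type*} [∀ i, Fintype (β i)] (f : ∀ i, β i → ℝ) :
    ∑ x : ∀ i, β i, ∏ i, f i (x i) = ∏ i, ∑ b, f i b := by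
  rw [prod_univ_sum, Fintype.piFinset_univ]

theorem lawOf_prod {β γ : ι → Type*} [∀ i, Fintype (β i)] (p : ∀ i, β i → ℝ)
    (g : ∀ i, β i → γ i) :
    lawOf (fun x : ∀ i, β i => ∏ i, p i (x i)) (fun x i => g i (x i)) =
      fun y => ∏ i, lawOf (p i) (g i) (y i) := by
  funext y
  simp_rw [fun i => lawOf_eq_sum_ite (p i) (g i) (y i)]
  rw [lawOf_eq_sum_ite]
  rw [← sum_prod_apply (fun i b => if g i b = y i then p i b else 0)]
  refine sum_congr rfl fun x _ => ?_
  rw [prod_ite_zero]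
  simp [funext_iff]

/-- Resampling one coordinate of a product pmf. -/
theorem sum_prod_resample {α : Type*} [Fintype α] (p : ι → α → ℝ) (i : ι) (hi : ∑ a, p i a = 1)
    (F : (ι → α) → ℝ) :
    ∑ x : ι → α, (∏ j, p j (x j)) * F x =
      ∑ x : ι → α, (∏ j, p j (x j)) * ∑ a, p i a * F (Function.update x i a) := by
  have key : ∀ G : (ι → α) → ℝ, ∑ x : ι → α, (∏ j, p j (x j)) * G x =
      ∑ r : {j // j ≠ i} → α, (∏ j, p j.1 (r j)) *
        ∑ a, p i a * G ((Equiv.funSplitAt i α).symm (a, r)) := by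
    intro G
    rw [← (Equiv.funSplitAt i α).symm.sum_comp, Fintype.sum_prod_type, sum_comm]
    refine sum_congr rfl fun r _ => ?_
    rw [mul_sum]
    refine sum_congr rfl fun a _ => ?_
    have : ∏ j, p j ((Equiv.funSplitAt i α).symm (a, r) j) = p i a * ∏ j : {j // j ≠ i}, p j.1 (r j) := by
      rw [Fintype.prod_eq_mul_prod_subtype_ne _ i]
      congr 1
      · simp [Equiv.funSplitAt]
      · refine prod_congr rfl fun j _ => ?_
        simp [Equiv.funSplitAt, j.2]
    rw [this]
    ring
  rw [key, key]
  refine sum_congr rfl fun r _ => ?_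
  congr 1
  have h : ∀ a b, Function.update ((Equiv.funSplitAt i α).symm (b, r)) i a =
      (Equiv.funSplitAt i α).symm (a, r) := by
    intro a b
    funext j
    by_cases hj : j = i
    · subst hj; simp [Equiv.funSplitAt]
    · simp [Equiv.funSplitAt, hj]
  simp_rw [h]
  rw [← sum_mul, hi, one_mul]

theorem sum_prod_mul_apply {α : Type*} [Fintype α] (p : ι → α → ℝ) (hp : ∀ i, ∑ a, p i a = 1)
    (i : ι) (f : α → ℝ) :
    ∑ x : ι → α, (∏ j, p j (x j)) * f (x i) = ∑ a, p i a * f a := by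
  rw [sum_prod_resample p i (hp i) (fun x => f (x i))]
  simp only [Function.update_self]
  rw [← sum_mul, sum_prod_apply]
  simp [hp]

/-- Conditioning one coordinate of a product pmf on a value. -/
theorem sum_prod_update {α : Type*} [Fintype α] (p : ι → α → ℝ) (i : ι) (hi : ∑ a, p i a = 1)
    (a : α) (F : (ι → α) → ℝ) :
    p i a * ∑ x : ι → α, (∏ j, p j (x j)) * F (Function.update x i a) =
      ∑ x : ι → α, (∏ j, p j (x j)) * if x i = a then F x else 0 := by
  rw [sum_prod_resample p i hi (fun x => if x i = a then F x else 0), mul_sum]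
  refine sum_congr rfl fun x _ => ?_
  simp
  ring

theorem entropy_prod {α : Type*} [Fintype α] (p : α → ℝ) (h1 : ∑ a, p a = 1) :
    entropy (fun x : ι → α => ∏ i, p (x i)) (fun x => x) =
      Fintype.card ι * entropy p (fun a => a) := by
  rw [entropy_eq_expect, entropy_eq_expect]
  have hpos : ∀ x : ι → α, (∏ i, p (x i)) * Real.logb 2 (∏ i, p (x i)) =
      ∑ i, (∏ j, p (x j)) * Real.logb 2 (p (x i)) := by
    intro x
    rw [← mul_sum]
    by_cases h : ∏ i, p (x i) = 0
    · simp [h]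
    · rw [Real.logb_prod]
      intro i _ h'
      exact h (prod_eq_zero (mem_univ i) h')
  simp_rw [lawOf_id, hpos]
  rw [sum_comm]
  simp_rw [sum_prod_mul_apply (fun _ => p) (fun _ => h1) _ (fun a => Real.logb 2 (p a))]
  simp

end ProductPmf

/-! ### A Carathéodory-type reduction of weights. -/

section Sparse

open scoped Classical
open Finset

/-- A nonnegative weight vector can be replaced by one with at most `card κ` nonzero entries that
has the same value on `card κ` linear functionals and no larger value on a further nonnegative
functional. -/
theorem exists_sparse_weights {ι κ : Type*} [Fintype ι] [Fintype κ] (L : ι → κ → ℝ) {c : ι → ℝ}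
    (hc : ∀ i, 0 ≤ c i) (w : ι → ℝ) (hw : ∀ i, 0 ≤ w i) :
    ∃ w' : ι → ℝ, (∀ i, 0 ≤ w' i) ∧ (∀ j, ∑ i, w' i * L i j = ∑ i, w i * L i j) ∧
      ∑ i, w' i * c i ≤ ∑ i, w i * c i ∧ #{i | w' i ≠ 0} ≤ Fintype.card κ := by
  induction h : #{i | w i ≠ 0} using Nat.strong_induction_on generalizing w with
  | _ m ih =>
    by_cases hm : m ≤ Fintype.card κ
    · exact ⟨w, hw, fun _ => rfl, le_rfl, h ▸ hm⟩
    push Not at hm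
    -- a direction supported on the support of `w` along which the functionals are constant
    let φ : ({i // w i ≠ 0} → ℝ) →ₗ[ℝ] (κ → ℝ) :=
      { toFun := fun v j => ∑ i, v i * L i.1 j
        map_add' := fun v v' => by
          funext j; simp [add_mul, sum_add_distrib]
        map_smul' := fun r v => by
          funext j; simp [mul_sum, mul_assoc] }
    have hker : LinearMap.ker φ ≠ ⊥ := by
      apply LinearMap.ker_ne_bot_of_finrank_lt
      simpa [Fintype.card_subtype, h] using hm
    obtain ⟨v₀, hv₀, hne⟩ := (Submodule.ne_bot_iff _).1 hker
    have hv₀' : ∀ j, ∑ i, v₀ i * L i.1 j = 0 := fun j => congrFun (LinearMap.mem_ker.1 hv₀) j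
    let ext : ({i // w i ≠ 0} → ℝ) → ι → ℝ := fun v i => if hi : w i ≠ 0 then v ⟨i, hi⟩ else 0
    have hext : ∀ f : ι → ℝ, ∑ i, ext v₀ i * f i = ∑ i, v₀ i * f i.1 := by
      intro f
      rw [← Fintype.sum_subtype_add_sum_subtype (fun i => w i ≠ 0) (fun i => ext v₀ i * f i),
        add_eq_left.2]
      · exact sum_congr rfl fun i _ => by simp [ext, i.2]
      · exact sum_eq_zero fun i _ => by simp [ext, not_not.1 i.2]
    obtain ⟨v, hvL, hvc, hvs, i₀, hi₀⟩ : ∃ v : ι → ℝ, (∀ j, ∑ i, v i * L i j = 0) ∧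
        ∑ i, v i * c i ≤ 0 ∧ (∀ i, w i = 0 → v i = 0) ∧ ∃ i, v i < 0 := by
      have hz : ∀ i, w i = 0 → ext v₀ i = 0 := fun i hi => by simp [ext, hi]
      have hnz : ∃ i, ext v₀ i ≠ 0 := by
        by_contra! hall
        apply hne
        funext i
        simpa [ext, i.2] using hall i.1
      have hL : ∀ j, ∑ i, ext v₀ i * L i j = 0 := fun j => by rw [hext (fun i => L i j), hv₀']
      -- Choose the sign so that the `c`-value does not increase. A negative entry is still needed
      -- to reach the boundary. If there is none, then c ≥ 0 forces the `c`-value to be 0 and the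
      -- opposite direction works.
      have main : ∀ v : ι → ℝ, (∑ i, v i * c i ≤ 0) → (∃ i, v i ≠ 0) →
          (∃ i, v i < 0) ∨ ∑ i, v i * c i = 0 ∧ ∃ i, 0 < v i := by
        intro v hv ⟨i, hi⟩
        by_cases hneg : ∃ i, v i < 0
        · exact Or.inl hneg
        · push Not at hneg
          exact Or.inr ⟨le_antisymm hv (sum_nonneg fun i _ => mul_nonneg (hneg i) (hc i)),
            i, lt_of_le_of_ne (hneg i) (Ne.symm hi)⟩
      have fin : ∀ v : ι → ℝ, (∀ j, ∑ i, v i * L i j = 0) → (∀ i, w i = 0 → v i = 0) →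
          (∃ i, v i ≠ 0) → ∑ i, v i * c i ≤ 0 → ∃ v : ι → ℝ, (∀ j, ∑ i, v i * L i j = 0) ∧
          ∑ i, v i * c i ≤ 0 ∧ (∀ i, w i = 0 → v i = 0) ∧ ∃ i, v i < 0 := by
        intro v h1 h2 h3 h4
        rcases main v h4 h3 with h5 | ⟨h5, i, hi⟩
        · exact ⟨v, h1, h4, h2, h5⟩
        · exact ⟨fun i => -v i, fun j => by simp [h1], by simp [h5], fun i hi => by simp [h2 i hi],
            i, by simpa using hi⟩
      rcases le_total (∑ i, ext v₀ i * c i) 0 with h0 | h0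
      · exact fin _ hL hz hnz h0
      · refine fin (fun i => -ext v₀ i) (fun j => by simp [hL]) (fun i hi => by simp [hz i hi])
          (by simpa using hnz) (by simpa using h0)
    -- move until the first entry vanishes
    obtain ⟨i₁, hi₁, hmin⟩ := exists_min_image ({i | v i < 0} : Finset ι) (fun i => w i / -v i)
      ⟨i₀, by simpa using hi₀⟩
    simp only [mem_filter, mem_univ, true_and] at hi₁ hmin
    set t := w i₁ / -v i₁ with ht
    have ht0 : 0 ≤ t := div_nonneg (hw _) (by linarith)
    have hnn : ∀ i, 0 ≤ w i + t * v i := by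
      intro i
      by_cases hi : v i < 0
      · have := hmin i hi
        rw [le_div_iff₀ (by linarith)] at this
        linarith
      · push Not at hi
        have := hw i
        positivity
    have hzero : w i₁ + t * v i₁ = 0 := by
      rw [ht]
      field_simp [hi₁.ne]
      ring
    have hlt : #{i | w i + t * v i ≠ 0} < m := by
      rw [← h]
      apply card_lt_card
      rw [ssubset_iff_of_subset]
      · refine ⟨i₁, ?_, by simp [hzero]⟩
        simp only [mem_filter, mem_univ, true_and]
        intro h0
        exact hi₁.ne (hvs _ h0)
      · intro i
        simp only [mem_filter, mem_univ, true_and]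
        intro hi h0
        exact hi (by rw [h0, hvs i h0]; simp)
    obtain ⟨w', h1, h2, h3, h4⟩ := ih _ hlt (fun i => w i + t * v i) hnn rfl
    refine ⟨w', h1, fun j => ?_, ?_, h4⟩
    · rw [h2 j]
      simp_rw [add_mul, sum_add_distrib, mul_assoc, ← mul_sum]
      simp [hvL j]
    · refine h3.trans ?_
      simp_rw [add_mul, sum_add_distrib, mul_assoc, ← mul_sum]
      nlinarith

end Sparse

/-! ### The single-letter law with the channel output averaged out. -/

section Core

open scoped Classical
open Finset

namespace CascadeModel

variable {X₁ X₂ Y A Xh₁ Xh₂ U : Type*} [Fintype X₁] [Fintype X₂] [Fintype Y]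

theorem src_nonneg (M : CascadeModel X₁ X₂ Y A Xh₁ Xh₂) (x : X₁ × X₂) : 0 ≤ M.src x :=
  M.src_mem.1 x

theorem sum_src (M : CascadeModel X₁ X₂ Y A Xh₁ Xh₂) : ∑ x, M.src x = 1 := M.src_mem.2

theorem chan_nonneg (M : CascadeModel X₁ X₂ Y A Xh₁ Xh₂) (a : A) (x₁ : X₁) (x₂ : X₂) (y : Y) :
    0 ≤ M.chan a x₁ x₂ y := (M.chan_mem a x₁ x₂).1 y

theorem sum_chan (M : CascadeModel X₁ X₂ Y A Xh₁ Xh₂) (a : A) (x₁ : X₁) (x₂ : X₂) :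
    ∑ y, M.chan a x₁ x₂ y = 1 := (M.chan_mem a x₁ x₂).2

variable [Fintype A] [Fintype Xh₁] [Fintype U]

/-- The joint pmf of `((X₁, X₂), (A, U, X̂₁))`, without the channel output. -/
noncomputable def core (M : CascadeModel X₁ X₂ Y A Xh₁ Xh₂) (q : X₁ → X₂ → A × U × Xh₁ → ℝ) :
    (X₁ × X₂) × (A × U × Xh₁) → ℝ :=
  fun v => M.src v.1 * q v.1.1 v.1.2 v.2

theorem core_nonneg (M : CascadeModel X₁ X₂ Y A Xh₁ Xh₂) (T : TestChannel X₁ X₂ Y A Xh₁ Xh₂ U)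
    (v : (X₁ × X₂) × (A × U × Xh₁)) : 0 ≤ M.core T.q v :=
  mul_nonneg (M.src_nonneg _) ((T.q_mem _ _).1 _)

theorem sum_core_mul_fst (M : CascadeModel X₁ X₂ Y A Xh₁ Xh₂)
    (T : TestChannel X₁ X₂ Y A Xh₁ Xh₂ U) (f : X₁ × X₂ → ℝ) :
    ∑ v, M.core T.q v * f v.1 = ∑ x, M.src x * f x := by
  rw [Fintype.sum_prod_type]
  refine sum_congr rfl fun x _ => ?_
  simp_rw [core, mul_right_comm _ _ (f x)]
  rw [← mul_sum, (T.q_mem x.1 x.2).2, mul_one]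

theorem sum_core (M : CascadeModel X₁ X₂ Y A Xh₁ Xh₂) (T : TestChannel X₁ X₂ Y A Xh₁ Xh₂ U) :
    ∑ v, M.core T.q v = 1 := by
  simpa [M.sum_src] using M.sum_core_mul_fst T (fun _ => 1)

theorem lawOf_core_fst (M : CascadeModel X₁ X₂ Y A Xh₁ Xh₂)
    (T : TestChannel X₁ X₂ Y A Xh₁ Xh₂ U) : lawOf (M.core T.q) Prod.fst = M.src := by
  funext x
  rw [lawOf_eq_sum_ite]
  have := M.sum_core_mul_fst T (fun x' => if x' = x then 1 else 0)
  simpa using this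

theorem expect_joint (M : CascadeModel X₁ X₂ Y A Xh₁ Xh₂) (T : TestChannel X₁ X₂ Y A Xh₁ Xh₂ U)
    (f : X₁ × X₂ × A × U × Xh₁ × Y → ℝ) :
    expect (M.joint T) f = ∑ v : (X₁ × X₂) × (A × U × Xh₁), M.core T.q v *
      ∑ y, M.chan v.2.1 v.1.1 v.1.2 y * f (v.1.1, v.1.2, v.2.1, v.2.2.1, v.2.2.2, y) := by
  simp only [_root_.expect, joint, core, Fintype.sum_prod_type, mul_sum]
  refine sum_congr rfl fun _ _ => sum_congr rfl fun _ _ => sum_congr rfl fun _ _ =>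
    sum_congr rfl fun _ _ => sum_congr rfl fun _ _ => sum_congr rfl fun _ _ => ?_
  ring

theorem lawOf_joint (M : CascadeModel X₁ X₂ Y A Xh₁ Xh₂) (T : TestChannel X₁ X₂ Y A Xh₁ Xh₂ U) :
    lawOf (M.joint T) (fun ω => ((ω.1, ω.2.1), (ω.2.2.1, ω.2.2.2.1, ω.2.2.2.2.1))) =
      M.core T.q := by
  funext v
  rw [lawOf_eq_sum_ite]
  have := M.expect_joint T
    (fun ω => if ((ω.1, ω.2.1), (ω.2.2.1, ω.2.2.2.1, ω.2.2.2.2.1)) = v then 1 else 0)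
  simp only [_root_.expect, mul_ite, mul_one, mul_zero] at this
  rw [this, sum_eq_single v]
  · simp [M.sum_chan]
  · intro b _ hb
    have : ¬ ((b.1.1, b.1.2), b.2.1, b.2.2.1, b.2.2.2) = v := hb
    simp [this]
  · simp

/-- The output Y does not enter, and the first term is fixed by the source. Only the conditional
entropy depends on the test channel, which gives both the linearity used to reduce U and the
continuity used in the compactness argument. -/
theorem info₂₃_eq (M : CascadeModel X₁ X₂ Y A Xh₁ Xh₂) (T : TestChannel X₁ X₂ Y A Xh₁ Xh₂ U) :
    M.info₂₃ T = entropy M.src (fun x => x) -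
      condEntropy (M.core T.q) (fun v => v.1) (fun v => (v.2.2.1, v.2.1)) := by
  rw [← M.lawOf_core_fst T, ← entropy_comp, ← M.lawOf_joint T, ← condEntropy_comp,
    ← entropy_comp (M.joint T) (fun ω => ((ω.1, ω.2.1), (ω.2.2.1, ω.2.2.2.1, ω.2.2.2.2.1)))]
  rfl

theorem info₁₂_eq (M : CascadeModel X₁ X₂ Y A Xh₁ Xh₂) (T : TestChannel X₁ X₂ Y A Xh₁ Xh₂ U) :
    M.info₁₂ T = condEntropy M.src (fun x => x.1) (fun x => x.2) -
      condEntropy (M.core T.q) (fun v => v.1.1)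
        (fun v => ((v.2.2.1, v.2.1, v.2.2.2), v.1.2)) := by
  rw [← M.lawOf_core_fst T, ← condEntropy_comp, ← M.lawOf_joint T, ← condEntropy_comp,
    ← condEntropy_comp (M.joint T) (fun ω => ((ω.1, ω.2.1), (ω.2.2.1, ω.2.2.2.1, ω.2.2.2.2.1)))]
  rfl

/-- Expected distortion at Node 2 given the sources, the action and the estimate. -/
noncomputable def dbar₁ (M : CascadeModel X₁ X₂ Y A Xh₁ Xh₂) (x : X₁ × X₂) (a : A) (z : Xh₁) : ℝ :=
  ∑ y, M.chan a x.1 x.2 y * M.d₁ x.1 x.2 y z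

/-- Expected distortion at Node 3 given the sources, the action and the estimation rule. -/
noncomputable def dbar₂ (M : CascadeModel X₁ X₂ Y A Xh₁ Xh₂) (x : X₁ × X₂) (a : A)
    (g : Y → Xh₂) : ℝ :=
  ∑ y, M.chan a x.1 x.2 y * M.d₂ x.1 x.2 y (g y)

/-- Averaging Y out beforehand makes all three constraints linear in the pmf of sources, action,
auxiliary variable and estimate; the coding argument then never involves Y. -/
theorem feasible_iff (M : CascadeModel X₁ X₂ Y A Xh₁ Xh₂) (T : TestChannel X₁ X₂ Y A Xh₁ Xh₂ U)
    (D₁ D₂ Γ : ℝ) :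
    M.Feasible T D₁ D₂ Γ ↔ ∑ v, M.core T.q v * M.cost v.2.1 ≤ Γ ∧
      ∑ v, M.core T.q v * M.dbar₁ v.1 v.2.1 v.2.2.2 ≤ D₁ ∧
      ∑ v, M.core T.q v * M.dbar₂ v.1 v.2.1 (T.xhat₂ v.2.2.1) ≤ D₂ := by
  rw [Feasible, expect_joint, expect_joint, expect_joint]
  simp only [dbar₁, dbar₂, ← sum_mul, M.sum_chan, one_mul]

end CascadeModel

end Core

/-! ### Cardinality bound for the auxiliary alphabet. -/

section Reduction

open scoped Classical
open Finset

variable {Ω α β γ δ : Type*} [Fintype Ω] [Fintype α] [Fintype β] [Fintype γ]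

theorem condEntropy_congr_ker {p : Ω → ℝ} (hp : ∀ ω, 0 ≤ p ω) {X : Ω → α} {X' : Ω → β} {Z : Ω → γ}
    [Fintype δ] {Z' : Ω → δ} (hX : ∀ ω ω', X ω' = X ω ↔ X' ω' = X' ω)
    (hZ : ∀ ω ω', Z ω' = Z ω ↔ Z' ω' = Z' ω) : condEntropy p X Z = condEntropy p X' Z' := by
  rw [condEntropy_eq_sub hp, condEntropy_eq_sub hp, entropy_congr_ker p hZ,
    entropy_congr_ker p (X := fun ω => (X ω, Z ω)) (Y := fun ω => (X' ω, Z' ω))]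
  intro ω ω'
  simp only [Prod.ext_iff, hX ω ω', hZ ω ω']

/-- The conditional entropy is linear in a reweighting that depends on the conditioning variable
only. -/
theorem condEntropy_reweight (p : Ω → ℝ) (X : Ω → α) (Z : Ω → γ) (g : Ω → δ) (r : δ → ℝ)
    (hg : ∀ ω ω', Z ω' = Z ω → g ω' = g ω) :
    condEntropy (fun ω => r (g ω) * p ω) X Z = ∑ ω, r (g ω) * (p ω *
      -Real.logb 2 (lawOf p (fun ω => (X ω, Z ω)) (X ω, Z ω) / lawOf p Z (Z ω))) := by
  have h : ∀ ω, lawOf (fun ω => r (g ω) * p ω) (fun ω => (X ω, Z ω)) (X ω, Z ω) =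
      r (g ω) * lawOf p (fun ω => (X ω, Z ω)) (X ω, Z ω) := by
    intro ω
    rw [lawOf_eq_sum_ite, lawOf_eq_sum_ite, mul_sum]
    refine sum_congr rfl fun ω' _ => ?_
    split_ifs with h
    · rw [hg _ _ (congrArg Prod.snd h)]
    · simp
  have h' : ∀ ω, lawOf (fun ω => r (g ω) * p ω) Z (Z ω) = r (g ω) * lawOf p Z (Z ω) := by
    intro ω
    rw [lawOf_eq_sum_ite, lawOf_eq_sum_ite, mul_sum]
    refine sum_congr rfl fun ω' _ => ?_
    split_ifs with h
    · rw [hg _ _ h]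
    · simp
  rw [condEntropy_eq_expect, ← sum_neg_distrib]
  refine sum_congr rfl fun ω _ => ?_
  rw [h ω, h' ω]
  by_cases hr : r (g ω) = 0
  · simp [hr]
  · rw [mul_div_mul_left _ _ hr]
    ring

namespace CascadeModel

variable {X₁ X₂ Y A Xh₁ Xh₂ U : Type*} [Fintype X₁] [Fintype X₂] [Fintype Y]

theorem dbar₁_nonneg (M : CascadeModel X₁ X₂ Y A Xh₁ Xh₂) (x : X₁ × X₂) (a : A) (z : Xh₁) :
    0 ≤ M.dbar₁ x a z :=
  sum_nonneg fun _ _ => mul_nonneg (M.chan_nonneg _ _ _ _) (M.d₁_nonneg _ _ _ _)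

theorem dbar₂_nonneg (M : CascadeModel X₁ X₂ Y A Xh₁ Xh₂) (x : X₁ × X₂) (a : A) (g : Y → Xh₂) :
    0 ≤ M.dbar₂ x a g :=
  sum_nonneg fun _ _ => mul_nonneg (M.chan_nonneg _ _ _ _) (M.d₂_nonneg _ _ _ _)

variable [Fintype A] [Fintype Xh₁] [Fintype U]

/-- Cardinality bound on the auxiliary alphabet. -/
theorem exists_small_testChannel (M : CascadeModel X₁ X₂ Y A Xh₁ Xh₂)
    (T : TestChannel X₁ X₂ Y A Xh₁ Xh₂ U) {D₁ D₂ Γ : ℝ} (hT : M.Feasible T D₁ D₂ Γ) :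
    ∃ k ≤ Fintype.card X₁ * Fintype.card X₂ + 4, ∃ T' : TestChannel X₁ X₂ Y A Xh₁ Xh₂ (Fin k),
      M.Feasible T' D₁ D₂ Γ ∧ M.info₁₂ T' = M.info₁₂ T ∧ M.info₂₃ T' = M.info₂₃ T := by
  let p := M.core T.q
  let slice : ((X₁ × X₂) × (A × U × Xh₁) → ℝ) → U → ℝ := fun f u =>
    ∑ v : (X₁ × X₂) × (A × U × Xh₁), if v.2.2.1 = u then p v * f v else 0
  have hslice : ∀ f (r : U → ℝ), ∑ u, r u * slice f u = ∑ v, r v.2.2.1 * (p v * f v) := by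
    intro f r
    simp only [slice, mul_sum]
    rw [sum_comm]
    refine sum_congr rfl fun v _ => ?_
    simp
  let X12 : (X₁ × X₂) × (A × U × Xh₁) → X₁ := fun v => v.1.1
  let Z12 : (X₁ × X₂) × (A × U × Xh₁) → (U × A × Xh₁) × X₂ :=
    fun v => ((v.2.2.1, v.2.1, v.2.2.2), v.1.2)
  let X23 : (X₁ × X₂) × (A × U × Xh₁) → X₁ × X₂ := fun v => v.1
  let Z23 : (X₁ × X₂) × (A × U × Xh₁) → U × A := fun v => (v.2.2.1, v.2.1)
  let h12 : (X₁ × X₂) × (A × U × Xh₁) → ℝ := fun v =>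
      -Real.logb 2 (lawOf p (fun v => (X12 v, Z12 v)) (X12 v, Z12 v) / lawOf p Z12 (Z12 v))
  let h23 : (X₁ × X₂) × (A × U × Xh₁) → ℝ := fun v =>
      -Real.logb 2 (lawOf p (fun v => (X23 v, Z23 v)) (X23 v, Z23 v) / lawOf p Z23 (Z23 v))
  let f1 : (X₁ × X₂) × (A × U × Xh₁) → ℝ := fun v => M.dbar₁ v.1 v.2.1 v.2.2.2
  let f2 : (X₁ × X₂) × (A × U × Xh₁) → ℝ := fun v => M.dbar₂ v.1 v.2.1 (T.xhat₂ v.2.2.1)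
  let f0 : (X₁ × X₂) × (A × U × Xh₁) → ℝ := fun v => M.cost v.2.1
  -- Preserved quantities: the total mass of p(·|x₁,x₂) for each of the |X₁||X₂| source pairs, two
  -- distortions and two conditional entropies. The cost need only not increase, so it does not
  -- count, whence |X₁||X₂| + 4. The masses at u are conditional on the source, so the new kernel is
  -- normalized even at source pairs of probability zero.
  let L : U → (X₁ × X₂) ⊕ Fin 4 → ℝ := fun u =>
    Sum.elim (fun x => ∑ a, ∑ z, T.q x.1 x.2 (a, u, z))
      ![slice f1 u, slice f2 u, slice h12 u, slice h23 u]
  have hp : ∀ v, 0 ≤ p v := M.core_nonneg T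
  obtain ⟨r, hr0, hrL, hrc, hcard⟩ := exists_sparse_weights L (c := slice f0)
    (fun u => sum_nonneg fun v _ => by
      split_ifs
      exacts [mul_nonneg (hp v) (M.cost_nonneg _), le_rfl]) (fun _ => 1) (fun _ => zero_le_one)
  set s : Finset U := {u | r u ≠ 0} with hs
  have hrs : ∀ u, u ∉ s → r u = 0 := fun u hu => by simpa [hs] using hu
  let e : Fin #s ≃ s := s.equivFin.symm
  let ι : (X₁ × X₂) × (A × Fin #s × Xh₁) → (X₁ × X₂) × (A × U × Xh₁) :=
    fun v => (v.1, v.2.1, (e v.2.2.1 : U), v.2.2.2)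
  have hesum : ∀ F : U → ℝ, (∀ u ∉ s, F u = 0) → ∑ j, F (e j) = ∑ u, F u := by
    intro F hF
    rw [e.sum_comp (fun u : s => F u), sum_coe_sort s F]
    exact sum_subset (subset_univ _) fun u _ hu => hF u hu
  have hq1 : ∀ x₁ x₂, ∑ w : A × Fin #s × Xh₁, r (e w.2.1) * T.q x₁ x₂ (w.1, (e w.2.1 : U), w.2.2)
      = 1 := by
    intro x₁ x₂
    have h1 := hrL (Sum.inl (x₁, x₂))
    simp only [L, Sum.elim_inl, one_mul] at h1
    have h2 := (T.q_mem x₁ x₂).2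
    simp only [Fintype.sum_prod_type] at h2 ⊢
    simp only [mul_sum] at h1
    rw [sum_comm] at h2 ⊢
    rw [hesum (fun u => ∑ a, ∑ z, r u * T.q x₁ x₂ (a, u, z))]
    · rw [h1, h2]
    · intro u hu
      simp [hrs u hu]
  let T' : TestChannel X₁ X₂ Y A Xh₁ Xh₂ (Fin #s) :=
    { q := fun x₁ x₂ w => r (e w.2.1) * T.q x₁ x₂ (w.1, (e w.2.1 : U), w.2.2)
      q_mem := fun x₁ x₂ => ⟨fun w => mul_nonneg (hr0 _) ((T.q_mem x₁ x₂).1 _), hq1 x₁ x₂⟩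
      xhat₂ := fun j => T.xhat₂ (e j) }
  -- Seen through the inclusion of the reduced alphabet in U, the new law is the old one reweighted
  -- by r(u).
  have hmaster : ∀ F : (X₁ × X₂) × (A × U × Xh₁) → ℝ,
      ∑ v, M.core T'.q v * F (ι v) = ∑ v, r v.2.2.1 * (p v * F v) := by
    intro F
    simp only [Fintype.sum_prod_type]
    refine sum_congr rfl fun x₁ _ => sum_congr rfl fun x₂ _ => sum_congr rfl fun a _ => ?_
    rw [← hesum (fun u => ∑ z, r u * (p ((x₁, x₂), a, u, z) * F ((x₁, x₂), a, u, z)))]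
    · refine sum_congr rfl fun j _ => sum_congr rfl fun z _ => ?_
      simp only [core, T', p, ι]
      ring
    · intro u hu
      simp [hrs u hu]
  have hlaw : lawOf (M.core T'.q) ι = fun v => r v.2.2.1 * p v := by
    funext v
    rw [lawOf_eq_sum_ite]
    have := hmaster (fun v' => if v' = v then 1 else 0)
    simpa using this
  have hone : ∀ f, ∑ u, (1 : ℝ) * slice f u = ∑ v, p v * f v := by
    intro f
    rw [hslice f (fun _ => 1)]
    simp
  refine ⟨#s, ?_, T', ?_, ?_, ?_⟩
  · simpa [hs] using hcard
  · rw [feasible_iff] at hT ⊢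
    refine ⟨le_trans (le_of_eq ?_) (hrc.trans ((hone f0).trans_le hT.1)),
      le_trans (le_of_eq ?_) hT.2.1, le_trans (le_of_eq ?_) hT.2.2⟩
    · rw [hslice, ← hmaster]
    · have := hrL (Sum.inr 0)
      simp only [L, Sum.elim_inr, Matrix.cons_val] at this
      rw [hslice, hone, ← hmaster] at this
      exact this
    · have := hrL (Sum.inr 1)
      simp only [L, Sum.elim_inr, Matrix.cons_val] at this
      rw [hslice, hone, ← hmaster] at this
      exact this
  · rw [info₁₂_eq, info₁₂_eq]
    congr 1
    rw [condEntropy_congr_ker (M.core_nonneg T') (X' := fun v => X12 (ι v))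
      (Z' := fun v => Z12 (ι v)) (fun _ _ => Iff.rfl), condEntropy_comp, hlaw,
      condEntropy_reweight p X12 Z12 (fun v => v.2.2.1) r, condEntropy_eq_expect, ← sum_neg_distrib]
    · have := hrL (Sum.inr 2)
      simp only [L, Sum.elim_inr, Matrix.cons_val] at this
      rw [hslice, hone] at this
      refine this.trans (sum_congr rfl fun v _ => ?_)
      simp only [h12, mul_neg]
      rfl
    · intro ω ω' h
      exact congrArg (fun t => t.1.1) h
    · intro v v'
      simp [Z12, ι, Subtype.ext_iff.symm]
  · rw [info₂₃_eq, info₂₃_eq]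
    congr 1
    rw [condEntropy_congr_ker (M.core_nonneg T') (X' := fun v => X23 (ι v))
      (Z' := fun v => Z23 (ι v)) (fun _ _ => Iff.rfl), condEntropy_comp, hlaw,
      condEntropy_reweight p X23 Z23 (fun v => v.2.2.1) r, condEntropy_eq_expect, ← sum_neg_distrib]
    · have := hrL (Sum.inr 3)
      simp only [L, Sum.elim_inr, Matrix.cons_val] at this
      rw [hslice, hone] at this
      refine this.trans (sum_congr rfl fun v _ => ?_)
      simp only [h23, mul_neg]
      rfl
    · intro ω ω' h
      exact congrArg (fun t => t.1) h
    · intro v v'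
      simp [Z23, ι, Subtype.ext_iff.symm]

end CascadeModel

end Reduction

/-! ### Removing the slack by compactness. -/

section Compactness

open scoped Classical
open Finset Filter Topology

theorem continuous_lawOf {Ω α : Type*} [Fintype Ω] (X : Ω → α) (a : α) :
    Continuous fun p : Ω → ℝ => lawOf p X a := by
  simp_rw [lawOf_eq_sum_ite]
  refine continuous_finsetSum _ fun ω _ => ?_
  split_ifs <;> fun_prop

theorem continuous_entropy {Ω α : Type*} [Fintype Ω] [Fintype α] (X : Ω → α) :
    Continuous fun p : Ω → ℝ => entropy p X := by
  have h : Continuous fun t : ℝ => t * Real.logb 2 t := by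
    have := Real.continuous_mul_log.div_const (Real.log 2)
    simpa only [Real.logb, mul_div_assoc] using this
  exact (continuous_finsetSum _ fun a _ => h.comp (continuous_lawOf X a)).neg

theorem continuousOn_condEntropy {Ω α γ : Type*} [Fintype Ω] [Fintype α] [Fintype γ] (X : Ω → α)
    (Z : Ω → γ) : ContinuousOn (fun p : Ω → ℝ => condEntropy p X Z) {p | ∀ ω, 0 ≤ p ω} := by
  refine ContinuousOn.congr (f := fun p : Ω → ℝ =>
    entropy p (fun ω => (X ω, Z ω)) - entropy p Z) ?_ fun p hp => condEntropy_eq_sub hp X Z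
  exact ((continuous_entropy _).sub (continuous_entropy _)).continuousOn

namespace CascadeModel

variable {X₁ X₂ Y A Xh₁ Xh₂ U : Type*} [Fintype X₁] [Fintype X₂] [Fintype Y]

theorem continuous_core (M : CascadeModel X₁ X₂ Y A Xh₁ Xh₂) :
    Continuous fun q : X₁ → X₂ → A × U × Xh₁ → ℝ => M.core q := by
  unfold core
  fun_prop

variable [Fintype A] [Fintype Xh₁] [Fintype Xh₂]

theorem isCompact_conditionalPmfs {X₁ X₂ A Xh₁ U : Type*} [Fintype A] [Fintype Xh₁] [Fintype U] :
    IsCompact {q : X₁ → X₂ → A × U × Xh₁ → ℝ | ∀ x₁ x₂, q x₁ x₂ ∈ stdSimplex ℝ (A × U × Xh₁)} := by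
  have h := isCompact_univ_pi (s := fun _ : X₁ => Set.univ.pi fun _ : X₂ =>
    stdSimplex ℝ (A × U × Xh₁)) fun _ => isCompact_univ_pi fun _ => isCompact_stdSimplex ℝ _
  convert h using 1
  ext q
  simp [Set.mem_pi]

/-- The single-letter constraints are closed: they hold once they hold up to every slack. -/
theorem exists_testChannel_of_forall_slack (M : CascadeModel X₁ X₂ Y A Xh₁ Xh₂) (K : ℕ)
    {D₁ D₂ Γ r₁ r₂ : ℝ}
    (h : ∀ ε > 0, ∃ k ≤ K, ∃ T : TestChannel X₁ X₂ Y A Xh₁ Xh₂ (Fin k),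
      M.Feasible T (D₁ + ε) (D₂ + ε) (Γ + ε) ∧ M.info₁₂ T ≤ r₁ + ε ∧ M.info₂₃ T ≤ r₂ + ε) :
    ∃ k ≤ K, ∃ T : TestChannel X₁ X₂ Y A Xh₁ Xh₂ (Fin k),
      M.Feasible T D₁ D₂ Γ ∧ M.info₁₂ T ≤ r₁ ∧ M.info₂₃ T ≤ r₂ := by
  by_contra hcon
  push Not at hcon
  -- The alphabet size and the rule x̂₂ take finitely many values, so it suffices to exclude small
  -- slack for each choice separately.
  have key : ∀ i : (Σ k : Fin (K + 1), (Fin k → Y → Xh₂)), ∀ᶠ ε : ℝ in 𝓝[>] 0,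
      ∀ T : TestChannel X₁ X₂ Y A Xh₁ Xh₂ (Fin i.1), T.xhat₂ = i.2 →
      ¬ (M.Feasible T (D₁ + ε) (D₂ + ε) (Γ + ε) ∧ M.info₁₂ T ≤ r₁ + ε ∧ M.info₂₃ T ≤ r₂ + ε) := by
    rintro ⟨k, xh⟩
    set Q := {q : X₁ → X₂ → A × Fin k × Xh₁ → ℝ | ∀ x₁ x₂, q x₁ x₂ ∈ stdSimplex ℝ (A × Fin k × Xh₁)}
      with hQ
    have hQc : IsCompact Q := isCompact_conditionalPmfs
    -- There may be no conditional pmf at all, for instance when k = 0.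
    rcases Q.eq_empty_or_nonempty with he | hne
    · refine Eventually.of_forall fun ε T _ => ?_
      have : T.q ∈ Q := T.q_mem
      simp [he] at this
    -- The largest violation among the five constraints. It attains its minimum on `Q`; a positive
    -- minimum excludes every smaller slack.
    let G : (X₁ → X₂ → A × Fin k × Xh₁ → ℝ) → ℝ := fun q =>
      max (max (∑ v, M.core q v * M.cost v.2.1 - Γ)
        (max (∑ v, M.core q v * M.dbar₁ v.1 v.2.1 v.2.2.2 - D₁)
          (∑ v, M.core q v * M.dbar₂ v.1 v.2.1 (xh v.2.2.1) - D₂)))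
        (max (condEntropy M.src (fun x => x.1) (fun x => x.2) -
          condEntropy (M.core q) (fun v => v.1.1)
          (fun v => ((v.2.2.1, v.2.1, v.2.2.2), v.1.2)) - r₁)
        (entropy M.src (fun x => x) -
          condEntropy (M.core q) (fun v => v.1) (fun v => (v.2.2.1, v.2.1)) - r₂))
    have hG : ∀ (T : TestChannel X₁ X₂ Y A Xh₁ Xh₂ (Fin k)), T.xhat₂ = xh → ∀ ε, G T.q ≤ ε ↔
        (M.Feasible T (D₁ + ε) (D₂ + ε) (Γ + ε) ∧ M.info₁₂ T ≤ r₁ + ε ∧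
          M.info₂₃ T ≤ r₂ + ε) := by
      rintro T rfl ε
      rw [feasible_iff, info₁₂_eq, info₂₃_eq]
      simp only [G, max_le_iff, sub_le_iff_le_add']
    have hlin : ∀ f : (X₁ × X₂) × (A × Fin k × Xh₁) → ℝ,
        Continuous fun q : X₁ → X₂ → A × Fin k × Xh₁ → ℝ => ∑ v, M.core q v * f v := by
      intro f
      have := M.continuous_core (U := Fin k)
      fun_prop
    have hent : ∀ {α γ : Type _} [Fintype α] [Fintype γ] (X : (X₁ × X₂) × (A × Fin k × Xh₁) → α)
        (Z : (X₁ × X₂) × (A × Fin k × Xh₁) → γ),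
        ContinuousOn (fun q => condEntropy (M.core q) X Z) Q := by
      intro α γ _ _ X Z
      refine (continuousOn_condEntropy X Z).comp M.continuous_core.continuousOn ?_
      intro q hq v
      exact mul_nonneg (M.src_nonneg _) ((hq _ _).1 _)
    have hent2 : ContinuousOn (fun q => condEntropy (M.core q) (fun v => v.1)
        (fun v : (X₁ × X₂) × (A × Fin k × Xh₁) => (v.2.2.1, v.2.1))) Q := by
      refine (continuousOn_condEntropy _ _).comp M.continuous_core.continuousOn ?_
      intro q hq v
      exact mul_nonneg (M.src_nonneg _) ((hq _ _).1 _)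
    have hGc : ContinuousOn G Q := by
      refine ContinuousOn.sup (ContinuousOn.sup ?_ (ContinuousOn.sup ?_ ?_)) (ContinuousOn.sup ?_ ?_)
      · exact ((hlin fun v => M.cost v.2.1).sub continuous_const).continuousOn
      · exact ((hlin fun v => M.dbar₁ v.1 v.2.1 v.2.2.2).sub continuous_const).continuousOn
      · exact ((hlin fun v => M.dbar₂ v.1 v.2.1 (xh v.2.2.1)).sub continuous_const).continuousOn
      · exact (continuousOn_const.sub (hent _ _)).sub continuousOn_const
      · exact (continuousOn_const.sub hent2).sub continuousOn_const
    obtain ⟨q₀, hq₀, hmin⟩ := hQc.exists_isMinOn hne hGc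
    have hpos : 0 < G q₀ := by
      by_contra! hle
      have h0 := (hG ⟨q₀, hq₀, xh⟩ rfl 0).1 hle
      simp only [add_zero] at h0
      exact absurd h0.2.2 (not_le.2 (hcon k (Nat.lt_succ_iff.1 k.2) _ h0.1 h0.2.1))
    filter_upwards [Ioo_mem_nhdsGT hpos] with ε hε T hT hall
    have h1 := (hG T hT ε).2 hall
    have h2 : G q₀ ≤ G T.q := hmin T.q_mem
    linarith [hε.2]
  obtain ⟨ε, hε, hε0⟩ := ((eventually_all.2 key).and self_mem_nhdsWithin).exists
  obtain ⟨k, hk, T, hT⟩ := h ε hε0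
  exact hε ⟨⟨k, Nat.lt_succ_iff.2 hk⟩, T.xhat₂⟩ T rfl hT

end CascadeModel

end Compactness

/-! ### Derandomization, time sharing and noise tables. -/

section Mixture

open scoped Classical
open Finset

variable {Ω α γ : Type*} [Fintype Ω] [Fintype α] [Fintype γ]

/-- The probabilistic method: it fixes the noise tables in the converse and the codebooks in the
achievability proof. -/
theorem exists_le_of_weighted_sum_le {q g : Ω → ℝ} (hq : ∀ ω, 0 ≤ q ω) (h1 : ∑ ω, q ω = 1) {B : ℝ}
    (h : ∑ ω, q ω * g ω ≤ B) : ∃ ω, g ω ≤ B := by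
  by_contra! hcon
  have hpos : ∃ ω, 0 < q ω := by
    by_contra! h0
    have : ∑ ω, q ω ≤ 0 := sum_nonpos fun ω _ => h0 ω
    linarith
  obtain ⟨ω₀, hω₀⟩ := hpos
  have : ∑ ω, q ω * B < ∑ ω, q ω * g ω :=
    sum_lt_sum (fun ω _ => mul_le_mul_of_nonneg_left (hcon ω).le (hq ω))
      ⟨ω₀, mem_univ _, mul_lt_mul_of_pos_left (hcon ω₀) hω₀⟩
  rw [← sum_mul, h1, one_mul] at this
  linarith

/-- Conditional entropy of a uniform mixture, when the conditioning variable reveals the mixture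
component. -/
theorem condEntropy_uniform_mixture {ι : Type*} [Fintype ι] [Nonempty ι] (p : Ω → ℝ)
    (X : ι × Ω → α) (Z : ι × Ω → γ) (hZ : ∀ s t, Z s = Z t → s.1 = t.1) :
    condEntropy (fun s : ι × Ω => (Fintype.card ι : ℝ)⁻¹ * p s.2) X Z =
      (Fintype.card ι : ℝ)⁻¹ * ∑ i, condEntropy p (fun ω => X (i, ω)) (fun ω => Z (i, ω)) := by
  have hn : (Fintype.card ι : ℝ)⁻¹ ≠ 0 := by simp
  have h1 : ∀ i ω, lawOf (fun s : ι × Ω => (Fintype.card ι : ℝ)⁻¹ * p s.2) Z (Z (i, ω)) =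
      (Fintype.card ι : ℝ)⁻¹ * lawOf p (fun ω => Z (i, ω)) (Z (i, ω)) := by
    intro i ω
    rw [lawOf_eq_sum_ite, lawOf_eq_sum_ite, Fintype.sum_prod_type, sum_eq_single i, mul_sum]
    · exact sum_congr rfl fun ω' _ => by simp
    · intro j _ hj
      exact sum_eq_zero fun ω' _ => if_neg fun h => hj (hZ _ _ h)
    · simp
  have h2 : ∀ i ω, lawOf (fun s : ι × Ω => (Fintype.card ι : ℝ)⁻¹ * p s.2) (fun s => (X s, Z s))
      (X (i, ω), Z (i, ω)) = (Fintype.card ι : ℝ)⁻¹ *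
        lawOf p (fun ω => (X (i, ω), Z (i, ω))) (X (i, ω), Z (i, ω)) := by
    intro i ω
    rw [lawOf_eq_sum_ite, lawOf_eq_sum_ite, Fintype.sum_prod_type, sum_eq_single i, mul_sum]
    · exact sum_congr rfl fun ω' _ => by simp
    · intro j _ hj
      exact sum_eq_zero fun ω' _ => if_neg fun h => hj (hZ _ _ (congrArg Prod.snd h))
    · simp
  rw [condEntropy_eq_expect, Fintype.sum_prod_type, mul_sum, ← sum_neg_distrib]
  refine sum_congr rfl fun i _ => ?_
  rw [condEntropy_eq_expect, mul_neg, mul_sum]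
  congr 1
  refine sum_congr rfl fun ω _ => ?_
  rw [h1, h2, mul_div_mul_left _ _ hn]
  ring

/-- Functional representation: a memoryless channel is driven by noise tables that do not depend
on its input. -/
theorem sum_prod_eq_sum_tables {ι S Y : Type*} [Fintype ι] [DecidableEq ι] [Fintype S]
    [DecidableEq S] [Fintype Y]
    (κ : S → Y → ℝ) (hκ : ∀ s, ∑ y, κ s y = 1) (s : ι → S) (F : (ι → Y) → ℝ) :
    ∑ y : ι → Y, (∏ j, κ (s j) (y j)) * F y =
      ∑ ν : ι → S → Y, (∏ j, ∏ t, κ t (ν j t)) * F (fun j => ν j (s j)) := by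
  rw [← sum_lawOf_mul (fun ν : ι → S → Y => ∏ j, ∏ t, κ t (ν j t)) (fun ν j => ν j (s j))]
  refine sum_congr rfl fun y _ => ?_
  rw [lawOf_prod (fun _ (f : S → Y) => ∏ t, κ t (f t)) (fun j f => f (s j))]
  congr 1
  refine prod_congr rfl fun j _ => ?_
  rw [lawOf_eq_sum_ite]
  have := sum_prod_mul_apply κ hκ (s j) (fun b => if b = y j then 1 else 0)
  simp only [mul_ite, mul_one, mul_zero, sum_ite_eq', mem_univ, if_true] at this
  exact this.symm

end Mixture

/-! ### Prefixes of a sequence and the chain rule. -/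

section Prefix

open scoped Classical
open Finset

variable {n : ℕ} {α μ : Type*}

/-- The first `i` symbols of a sequence. -/
def seqPrefix (i : ℕ) (ω : Fin n → α) : Fin n → Option α :=
  fun j => if j.val < i then some (ω j) else none

/-- Unseen symbols are masked rather than cut off, so prefixes of all lengths share one finite type
and fit in a single auxiliary alphabet. This equivalence drives the telescoping in the chain rule.
-/
theorem seqPrefix_succ_eq_iff (i : Fin n) (ω ω' : Fin n → α) :
    seqPrefix (i + 1) ω' = seqPrefix (i + 1) ω ↔
      seqPrefix i ω' = seqPrefix i ω ∧ ω' i = ω i := by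
  simp only [seqPrefix, funext_iff]
  constructor
  · intro h
    refine ⟨fun j => ?_, by simpa using h i⟩
    have := h j
    by_cases hj : j.val < i
    · simpa [hj, hj.trans (Nat.lt_succ_self _)] using this
    · simp [hj]
  · rintro ⟨h, hi⟩ j
    rcases lt_trichotomy j i with hj | rfl | hj
    · have := h j
      have hj' : j.val < i.val := hj
      simpa [hj', hj'.trans (Nat.lt_succ_self _)] using this
    · simp [hi]
    · have hj' : ¬ j.val < i.val + 1 := by
        have : i.val < j.val := hj
        omega
      simp [hj']

theorem seqPrefix_length_eq_iff (ω ω' : Fin n → α) :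
    seqPrefix n ω' = seqPrefix n ω ↔ ω' = ω := by
  simp [seqPrefix, funext_iff]

/-- Chain rule along a sequence, given a function of it. -/
theorem sum_condEntropy_seqPrefix [Fintype α] [Fintype μ] {p : (Fin n → α) → ℝ} (hp : ∀ ω, 0 ≤ p ω)
    (m : (Fin n → α) → μ) :
    ∑ i : Fin n, condEntropy p (fun ω => ω i) (fun ω => (m ω, seqPrefix i ω)) =
      entropy p (fun ω => ω) - entropy p m := by
  have h : ∀ i : Fin n, condEntropy p (fun ω => ω i) (fun ω => (m ω, seqPrefix i ω)) =
      entropy p (fun ω => (m ω, seqPrefix (i + 1) ω)) - entropy p (fun ω => (m ω, seqPrefix i ω)) := by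
    intro i
    rw [condEntropy_eq_sub hp]
    congr 1
    apply entropy_congr_ker
    intro ω ω'
    simp only [Prod.ext_iff, seqPrefix_succ_eq_iff]
    tauto
  simp_rw [h]
  -- The sum telescopes: the full prefix determines `m`, and the empty prefix carries no
  -- information.
  rw [Fin.sum_univ_eq_sum_range (fun i => entropy p (fun ω => (m ω, seqPrefix (i + 1) ω)) -
    entropy p (fun ω => (m ω, seqPrefix i ω))), sum_range_sub (fun i => entropy p (fun ω =>
    (m ω, seqPrefix i ω)))]
  congr 1
  · apply entropy_congr_ker
    intro ω ω'
    simp only [Prod.ext_iff, seqPrefix_length_eq_iff]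
    exact ⟨fun h => h.2, fun h => ⟨by rw [h], h⟩⟩
  · apply entropy_congr_ker
    intro ω ω'
    have : seqPrefix 0 ω' = seqPrefix 0 ω := by
      funext j
      simp [seqPrefix]
    simp [Prod.ext_iff, this]

end Prefix

/-! ### Expectations under a block code. -/

section Block

open scoped Classical
open Finset

namespace CascadeModel

variable {X₁ X₂ Y A Xh₁ Xh₂ : Type*} [Fintype X₁] [Fintype X₂] [Fintype Y] {n : ℕ} {R₁₂ R₂₃ : ℝ}

/-- Pmf of a block of source pairs. -/
noncomputable def blockSrc (M : CascadeModel X₁ X₂ Y A Xh₁ Xh₂) (n : ℕ) (ω : Fin n → X₁ × X₂) : ℝ :=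
  ∏ i, M.src (ω i)

theorem blockSrc_nonneg (M : CascadeModel X₁ X₂ Y A Xh₁ Xh₂) (ω : Fin n → X₁ × X₂) :
    0 ≤ M.blockSrc n ω := prod_nonneg fun _ _ => M.src_nonneg _

theorem sum_blockSrc (M : CascadeModel X₁ X₂ Y A Xh₁ Xh₂) : ∑ ω, M.blockSrc n ω = 1 := by
  simp only [blockSrc]
  rw [sum_prod_apply (fun (_ : Fin n) b => M.src b)]
  simp [M.sum_src]

theorem expect_blockPmf (M : CascadeModel X₁ X₂ Y A Xh₁ Xh₂)
    (c : CascadeCode X₁ X₂ Y A Xh₁ Xh₂ n R₁₂ R₂₃)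
    (f : (Fin n → X₁) × (Fin n → X₂) × (Fin n → Y) → ℝ) :
    expect (M.blockPmf c) f = ∑ ω : Fin n → X₁ × X₂, M.blockSrc n ω * ∑ y : Fin n → Y,
      (∏ i, M.chan (c.action (fun i => (ω i).1) (fun i => (ω i).2) i) (ω i).1 (ω i).2 (y i)) *
        f (fun i => (ω i).1, fun i => (ω i).2, y) := by
  rw [← (Equiv.arrowProdEquivProdArrow (Fin n) (fun _ => X₁) (fun _ => X₂)).symm.sum_comp]
  simp only [_root_.expect, Fintype.sum_prod_type, mul_sum, blockPmf, blockSrc]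
  refine sum_congr rfl fun _ _ => sum_congr rfl fun _ _ => sum_congr rfl fun _ _ => ?_
  simp only [Equiv.arrowProdEquivProdArrow_symm_apply]
  ring

theorem expect_blockPmf_cost (M : CascadeModel X₁ X₂ Y A Xh₁ Xh₂)
    (c : CascadeCode X₁ X₂ Y A Xh₁ Xh₂ n R₁₂ R₂₃) (i : Fin n) :
    expect (M.blockPmf c) (fun (x₁, x₂, _) => M.cost (c.action x₁ x₂ i)) =
      ∑ ω : Fin n → X₁ × X₂, M.blockSrc n ω *
        M.cost (c.action (fun i => (ω i).1) (fun i => (ω i).2) i) := by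
  rw [expect_blockPmf]
  refine sum_congr rfl fun ω _ => ?_
  simp only []
  rw [← sum_mul, sum_prod_apply (fun j b => M.chan (c.action (fun i => (ω i).1)
    (fun i => (ω i).2) j) (ω j).1 (ω j).2 b)]
  simp [M.sum_chan]

/-- The estimate at Node 2 ignores the outputs, so given the sources only the channel at time i
matters. At Node 3 the estimate also depends on past outputs, and a separate argument is needed. -/
theorem expect_blockPmf_d₁ (M : CascadeModel X₁ X₂ Y A Xh₁ Xh₂)
    (c : CascadeCode X₁ X₂ Y A Xh₁ Xh₂ n R₁₂ R₂₃) (i : Fin n) :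
    expect (M.blockPmf c) (fun (x₁, x₂, y) => M.d₁ (x₁ i) (x₂ i) (y i) (c.est₁ x₁ x₂ i)) =
      ∑ ω : Fin n → X₁ × X₂, M.blockSrc n ω *
        M.dbar₁ (ω i) (c.action (fun i => (ω i).1) (fun i => (ω i).2) i)
          (c.est₁ (fun i => (ω i).1) (fun i => (ω i).2) i) := by
  rw [expect_blockPmf]
  refine sum_congr rfl fun ω _ => ?_
  congr 1
  exact sum_prod_mul_apply (fun j b => M.chan (c.action (fun i => (ω i).1)
    (fun i => (ω i).2) j) (ω j).1 (ω j).2 b) (fun _ => M.sum_chan _ _ _) i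
    (fun y => M.d₁ (ω i).1 (ω i).2 y (c.est₁ (fun i => (ω i).1) (fun i => (ω i).2) i))

end CascadeModel

end Block

/-! ### Converse: from a code to a single-letter test channel. -/

section Converse

open scoped Classical
open Finset

theorem logb_le_of_le_msgCount {n : ℕ} {R : ℝ} {m : ℕ} (hm : 0 < m) (h : m ≤ msgCount n R) :
    Real.logb 2 m ≤ n * R := by
  rw [Real.logb_le_iff_le_rpow one_lt_two (by exact_mod_cast hm)]
  calc (m : ℝ) ≤ (msgCount n R : ℝ) := by exact_mod_cast h
    _ ≤ _ := Nat.floor_le (by positivity)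

namespace CascadeModel

variable {X₁ X₂ Y A Xh₁ Xh₂ : Type*} [Fintype X₁] [Fintype X₂] [Fintype Y] {n : ℕ} {R₁₂ R₂₃ : ℝ}

/-- Estimation rule of Node 3 at time `i` as a function of the message, the past source symbols,
fixed noise tables for the past, and the current channel output. -/
noncomputable def pastRule (c : CascadeCode X₁ X₂ Y A Xh₁ Xh₂ n R₁₂ R₂₃)
    (ν : Fin n → A × X₁ × X₂ → Y) (i : Fin n) (m : Fin (msgCount n R₂₃))
    (past : Fin n → Option (X₁ × X₂)) (y : Y) : Xh₂ :=
  c.h₂ i m fun j => if Fin.castLE i.isLt j = i then y else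
    -- The default `y` is never reached when `past` is the prefix of length i, since then j < i. The
    -- past action needs only the message.
    (past (Fin.castLE i.isLt j)).elim y fun x => ν (Fin.castLE i.isLt j)
      (c.act m (Fin.castLE i.isLt j), x)

/-- The past channel outputs can be replaced by a deterministic function of the message and of the
past source symbols, without increasing the distortion at time `i`. -/
theorem exists_pastRule (M : CascadeModel X₁ X₂ Y A Xh₁ Xh₂) [Fintype A]
    (c : CascadeCode X₁ X₂ Y A Xh₁ Xh₂ n R₁₂ R₂₃) (i : Fin n) :
    ∃ ν : Fin n → A × X₁ × X₂ → Y,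
      ∑ ω : Fin n → X₁ × X₂, M.blockSrc n ω *
        M.dbar₂ (ω i) (c.action (fun i => (ω i).1) (fun i => (ω i).2) i)
          (pastRule c ν i (c.msg₂₃ (fun i => (ω i).1) (fun i => (ω i).2)) (seqPrefix i ω)) ≤
      expect (M.blockPmf c) (fun (x₁, x₂, y) =>
        M.d₂ (x₁ i) (x₂ i) (y i) (c.est₂ x₁ x₂ y i)) := by
  let κ : A × X₁ × X₂ → Y → ℝ := fun t => M.chan t.1 t.2.1 t.2.2
  have hκ : ∀ t, ∑ y, κ t y = 1 := fun t => M.sum_chan _ _ _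
  let Q : (Fin n → A × X₁ × X₂ → Y) → ℝ := fun ν => ∏ j, ∏ t, κ t (ν j t)
  have hQ0 : ∀ ν, 0 ≤ Q ν := fun ν => prod_nonneg fun _ _ => prod_nonneg fun _ _ =>
    M.chan_nonneg _ _ _ _
  have hQ1 : ∑ ν, Q ν = 1 := by
    simp only [Q]
    rw [sum_prod_apply (fun (_ : Fin n) (f : A × X₁ × X₂ → Y) => ∏ t, κ t (f t))]
    simp_rw [sum_prod_apply κ, hκ]
    simp
  refine exists_le_of_weighted_sum_le hQ0 hQ1 (le_of_eq ?_)
  rw [expect_blockPmf]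
  simp_rw [mul_sum, mul_left_comm (Q _)]
  rw [sum_comm]
  refine sum_congr rfl fun ω _ => ?_
  rw [← mul_sum, ← mul_sum]
  congr 1
  let a : Fin n → A := c.action (fun i => (ω i).1) (fun i => (ω i).2)
  let s : Fin n → A × X₁ × X₂ := fun j => (a j, ω j)
  let F : (Fin n → Y) → ℝ := fun y =>
    M.d₂ (ω i).1 (ω i).2 (y i) (c.est₂ (fun i => (ω i).1) (fun i => (ω i).2) y i)
  -- The output at time i is split off first and stays random; only then are the other outputs
  -- expressed through tables. A past output is the table entry at (action, sources), which the
  -- message and the prefix determine.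
  have h1 := sum_prod_resample (fun j => κ (s j)) i (hκ _) F
  have h2 := sum_prod_eq_sum_tables κ hκ s
    (fun y => ∑ b, κ (s i) b * F (Function.update y i b))
  refine Eq.trans ?_ (h1.trans h2).symm
  refine sum_congr rfl fun ν _ => ?_
  congr 1
  refine sum_congr rfl fun b _ => ?_
  simp only [κ, s, F, Function.update_self]
  congr 2
  rw [pastRule, CascadeCode.est₂]
  congr 1
  funext j
  by_cases hj : Fin.castLE i.isLt j = i
  · simp [hj]
  · have hlt : (Fin.castLE i.isLt j).val < i.val := by
      have h3 : (Fin.castLE i.isLt j).val ≤ i.val := Nat.lt_succ_iff.1 j.isLt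
      exact lt_of_le_of_ne h3 fun h => hj (Fin.ext h)
    rw [if_neg hj, Function.update_of_ne hj, seqPrefix, if_pos hlt]
    rfl

/-- Every code of positive length gives a single-letter test channel with no larger cost,
distortions and informations. -/
theorem exists_testChannel_of_code [Fintype A] [Fintype Xh₁]
    (M : CascadeModel X₁ X₂ Y A Xh₁ Xh₂) (hn : 0 < n)
    (c : CascadeCode X₁ X₂ Y A Xh₁ Xh₂ n R₁₂ R₂₃) {D₁ D₂ Γ : ℝ} (hc : M.Meets c D₁ D₂ Γ) :
    ∃ T : TestChannel X₁ X₂ Y A Xh₁ Xh₂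
        (Fin n × Fin (msgCount n R₂₃) × (Fin n → Option (X₁ × X₂))),
      M.Feasible T D₁ D₂ Γ ∧ M.info₁₂ T ≤ R₁₂ ∧ M.info₂₃ T ≤ R₂₃ := by
  have : Nonempty (Fin n) := ⟨⟨0, hn⟩⟩
  have hn' : (0 : ℝ) < n := by exact_mod_cast hn
  choose ν hν using M.exists_pastRule c
  let P : (Fin n → X₁ × X₂) → ℝ := M.blockSrc n
  have hP0 : ∀ ω, 0 ≤ P ω := M.blockSrc_nonneg
  have hP1 : ∑ ω, P ω = 1 := M.sum_blockSrc
  let x2 : (Fin n → X₁ × X₂) → Fin n → X₂ := fun ω i => (ω i).2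
  let m12 : (Fin n → X₁ × X₂) → Fin (msgCount n R₁₂) := fun ω =>
    c.msg₁₂ (fun i => (ω i).1) (fun i => (ω i).2)
  let m23 : (Fin n → X₁ × X₂) → Fin (msgCount n R₂₃) := fun ω =>
    c.msg₂₃ (fun i => (ω i).1) (fun i => (ω i).2)
  let W : Fin n → (Fin n → X₁ × X₂) →
      A × (Fin n × Fin (msgCount n R₂₃) × (Fin n → Option (X₁ × X₂))) × Xh₁ := fun i ω =>
    (c.act (m23 ω) i, (i, m23 ω, seqPrefix i ω), c.h₁ (m12 ω) (x2 ω) i)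
  let T : TestChannel X₁ X₂ Y A Xh₁ Xh₂
      (Fin n × Fin (msgCount n R₂₃) × (Fin n → Option (X₁ × X₂))) :=
    -- The i-th source pair is overwritten by (x₁,x₂). As the source is i.i.d., this is a
    -- conditional law given that pair, defined without division also at pairs of probability zero.
    { q := fun x₁ x₂ w => (n : ℝ)⁻¹ * ∑ i, ∑ ω, P ω *
        if W i (Function.update ω i (x₁, x₂)) = w then 1 else 0
      q_mem := fun x₁ x₂ => ⟨fun w => by
          refine mul_nonneg (by positivity) (sum_nonneg fun i _ => sum_nonneg fun ω _ =>
            mul_nonneg (hP0 _) ?_)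
          split_ifs <;> norm_num, by
          rw [← mul_sum, sum_comm]
          simp_rw [sum_comm (s := univ (α := A × _)), ← mul_sum]
          simp [hP1, hn'.ne']⟩
      xhat₂ := fun u => pastRule c (ν u.1) u.1 u.2.1 u.2.2 }
  let V : Fin n × (Fin n → X₁ × X₂) → (X₁ × X₂) ×
      (A × (Fin n × Fin (msgCount n R₂₃) × (Fin n → Option (X₁ × X₂))) × Xh₁) :=
    fun s => (s.2 s.1, W s.1 s.2)
  let P' : Fin n × (Fin n → X₁ × X₂) → ℝ := fun s => (Fintype.card (Fin n) : ℝ)⁻¹ * P s.2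
  have hcore : M.core T.q = lawOf P' V := by
    funext v
    rw [lawOf_eq_sum_ite, Fintype.sum_prod_type, core]
    simp only [T, P', Fintype.card_fin]
    rw [mul_left_comm, mul_sum, mul_sum]
    refine sum_congr rfl fun i _ => ?_
    have := sum_prod_update (fun _ : Fin n => M.src) i M.sum_src v.1
      (fun ω => if W i ω = v.2 then 1 else 0)
    refine (congrArg _ this).trans ?_
    rw [mul_sum]
    refine sum_congr rfl fun ω _ => ?_
    simp only [V, Prod.ext_iff (x := (_, _)), ← ite_and]
    split_ifs <;> simp [P, blockSrc]
  have hsum : ∀ f : _ → ℝ, ∑ v, M.core T.q v * f v = 1 / (n : ℝ) * ∑ i, ∑ ω, P ω * f (V (i, ω)) := by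
    intro f
    rw [hcore, sum_lawOf_mul, Fintype.sum_prod_type, mul_sum]
    simp_rw [mul_sum]
    refine sum_congr rfl fun i _ => sum_congr rfl fun ω _ => ?_
    simp only [P', Fintype.card_fin]
    ring
  have hHsrc : entropy P (fun ω => ω) = n * entropy M.src (fun x => x) := by
    have := entropy_prod (ι := Fin n) M.src M.sum_src
    rwa [Fintype.card_fin] at this
  have hHx2 : entropy P x2 = n * entropy M.src (fun x => x.2) := by
    have h1 := lawOf_prod (fun (_ : Fin n) => M.src) (fun _ (x : X₁ × X₂) => x.2)
    have h2 := entropy_prod (ι := Fin n) (lawOf M.src (fun x => x.2))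
      (by rw [sum_lawOf, M.sum_src])
    rw [Fintype.card_fin, ← entropy_comp M.src (fun x => x.2) (fun x => x), ← h1,
      ← entropy_comp (fun x : Fin n → X₁ × X₂ => ∏ i, M.src (x i)) (fun x i => (x i).2)
        (fun x => x)] at h2
    exact h2
  have hcard : ∀ {R : ℝ}, Nonempty (Fin (msgCount n R)) →
      Real.logb 2 (Fintype.card (Fin (msgCount n R))) ≤ n * R := by
    intro R ⟨i⟩
    rw [Fintype.card_fin]
    exact logb_le_of_le_msgCount (Fin.pos i) le_rfl
  -- A source block exists, so the message sets are nonempty and the logarithms of their sizes are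
  -- bounded by n times the rates.
  obtain ⟨ω₀⟩ : Nonempty (Fin n → X₁ × X₂) := by
    by_contra h
    rw [not_nonempty_iff] at h
    simp at hP1
  refine ⟨T, ?_, ?_, ?_⟩
  · rw [feasible_iff, hsum, hsum, hsum]
    obtain ⟨h0, h1, h2⟩ := hc
    rw [Nat.cast_one] at h0 h1 h2
    refine ⟨le_trans (le_of_eq ?_) h0, le_trans (le_of_eq ?_) h1, le_trans ?_ h2⟩
    · simp_rw [expect_blockPmf_cost]
      rfl
    · simp_rw [expect_blockPmf_d₁]
      rfl
    · exact mul_le_mul_of_nonneg_left (sum_le_sum fun i _ => hν i) (by positivity)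
  · have hmix : condEntropy (M.core T.q) (fun v => v.1.1)
        (fun v => ((v.2.2.1, v.2.1, v.2.2.2), v.1.2)) = (n : ℝ)⁻¹ * ∑ i : Fin n,
        condEntropy P (fun ω => (ω i).1) (fun ω => (((i, m23 ω, seqPrefix i ω), c.act (m23 ω) i,
          c.h₁ (m12 ω) (x2 ω) i), x2 ω i)) := by
      rw [hcore, ← condEntropy_comp]
      have := condEntropy_uniform_mixture (ι := Fin n) P (fun s => (V s).1.1)
        (fun s => (((V s).2.2.1, (V s).2.1, (V s).2.2.2), (V s).1.2))
        (fun s t h => congrArg (fun r => r.1.1.1) h)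
      rw [Fintype.card_fin] at this
      rw [← this]
      simp [P']
    -- All of U, A, X̂₁ and X_{2i} are functions of (M₁₂, X₂ⁿ, past), and since X₂ⁿ is given, the
    -- uncertainty of the pair at time i is that of X_{1i} alone.
    have hge : ∀ i : Fin n, condEntropy P (fun ω => ω i)
        (fun ω => ((m12 ω, x2 ω), seqPrefix i ω)) ≤
        condEntropy P (fun ω => (ω i).1) (fun ω => (((i, m23 ω, seqPrefix i ω), c.act (m23 ω) i,
          c.h₁ (m12 ω) (x2 ω) i), x2 ω i)) := by
      intro i
      have h1 := condEntropy_le_comp hP0 (fun ω => (ω i).1)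
        (fun ω => ((m12 ω, x2 ω), seqPrefix i ω))
        (fun t => (((i, c.g₂ t.1.2 t.1.1, t.2), c.act (c.g₂ t.1.2 t.1.1) i,
          c.h₁ t.1.1 t.1.2 i), t.1.2 i))
      refine le_trans (le_of_eq ?_) h1
      rw [condEntropy_eq_sub hP0, condEntropy_eq_sub hP0]
      congr 1
      apply entropy_congr_ker
      intro ω ω'
      simp only [Prod.ext_iff]
      have : x2 ω' = x2 ω → (ω' i).2 = (ω i).2 := fun h => congrFun h i
      tauto
    have hsumge := sum_le_sum fun i (_ : i ∈ univ) => hge i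
    rw [sum_condEntropy_seqPrefix hP0 (fun ω => (m12 ω, x2 ω))] at hsumge
    rw [info₁₂_eq, hmix, condEntropy_eq_sub M.src_nonneg]
    -- This is H(M₁₂ | X₂ⁿ) ≤ H(M₁₂) ≤ nR₁₂.
    have h3 : entropy P (fun ω => (m12 ω, x2 ω)) - entropy P x2 ≤ n * R₁₂ := by
      rw [← condEntropy_eq_sub hP0]
      exact (condEntropy_le_entropy hP0 hP1 _ _).trans
        ((entropy_le_logb_card hP0 hP1 _).trans (hcard ⟨m12 ω₀⟩))
    have h4 : entropy M.src (fun ω => (ω.1, ω.2)) = entropy M.src (fun x => x) := rfl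
    rw [h4, sub_le_iff_le_add, inv_mul_eq_div, ← sub_le_iff_le_add', le_div_iff₀ hn']
    rw [hHsrc] at hsumge
    rw [hHx2] at h3
    nlinarith
  · have hmix : condEntropy (M.core T.q) (fun v => v.1) (fun v => (v.2.2.1, v.2.1)) =
        (n : ℝ)⁻¹ * ∑ i : Fin n,
        condEntropy P (fun ω => ω i) (fun ω => ((i, m23 ω, seqPrefix i ω), c.act (m23 ω) i)) := by
      rw [hcore, ← condEntropy_comp]
      have := condEntropy_uniform_mixture (ι := Fin n) P (fun s => (V s).1)
        (fun s => ((V s).2.2.1, (V s).2.1)) (fun s t h => congrArg (fun r => r.1.1) h)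
      rw [Fintype.card_fin] at this
      rw [← this]
      simp [P']
    have heq : ∀ i : Fin n, condEntropy P (fun ω => ω i)
        (fun ω => ((i, m23 ω, seqPrefix i ω), c.act (m23 ω) i)) =
        condEntropy P (fun ω => ω i) (fun ω => (m23 ω, seqPrefix i ω)) := by
      intro i
      apply condEntropy_congr_ker hP0 (fun _ _ => Iff.rfl)
      intro ω ω'
      simp only [Prod.ext_iff]
      have : m23 ω' = m23 ω → c.act (m23 ω') i = c.act (m23 ω) i := fun h => by rw [h]
      tauto
    rw [info₂₃_eq, hmix]
    simp_rw [heq]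
    rw [sum_condEntropy_seqPrefix hP0 m23, hHsrc]
    have h3 := (entropy_le_logb_card hP0 hP1 m23).trans (hcard ⟨m23 ω₀⟩)
    rw [sub_le_iff_le_add, inv_mul_eq_div, ← sub_le_iff_le_add', le_div_iff₀ hn']
    nlinarith

end CascadeModel

end Converse

/-! ### One-shot covering and the one-shot cascade code. -/

section OneShot

open scoped Classical
open Finset

/-- After (1 - p)^K ≤ e^{-Kp}, convexity of exp between -K/B and 0 with weights α and 1 - α
separates the missing mass 1 - α from a term that vanishes once K is much larger than B. -/
theorem one_sub_pow_le {α p B : ℝ} (hα0 : 0 ≤ α) (hα1 : α ≤ 1) (hp1 : p ≤ 1)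
    (hp : α / B ≤ p) (K : ℕ) : (1 - p) ^ K ≤ 1 - α + Real.exp (-(K / B)) := by
  have h1 : (1 - p) ^ K ≤ Real.exp (-(K * (α / B))) := by
    calc (1 - p) ^ K ≤ Real.exp (-p) ^ K := by
          gcongr
          linarith [Real.add_one_le_exp (-p)]
      _ = Real.exp (-(K * p)) := by rw [← Real.exp_nat_mul]; ring_nf
      _ ≤ _ := by gcongr
  have h2 := convexOn_exp.2 (Set.mem_univ (-(K / B))) (Set.mem_univ (0 : ℝ)) hα0
    (sub_nonneg.2 hα1) (by ring)
  simp only [smul_eq_mul, mul_zero, add_zero, Real.exp_zero, mul_one] at h2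
  have h3 : Real.exp (-(K * (α / B))) = Real.exp (α * -(K / B)) := by ring_nf
  have h4 : α * Real.exp (-(K / B)) ≤ Real.exp (-(K / B)) :=
    mul_le_of_le_one_left (Real.exp_pos _).le hα1
  linarith

/-- Probability that `K` independent draws from `q` all miss a set on which a (sub)pmf `ρ`
dominated by `B q` has mass at least `α`. -/
theorem prob_all_miss_le {δ : Type*} [Fintype δ] {q ρ : δ → ℝ} (hq0 : ∀ z, 0 ≤ q z)
    (hq1 : ∑ z, q z = 1) {T : δ → Prop} {B : ℝ} (hB : 0 < B) (hρ : ∀ z, T z → ρ z ≤ B * q z) {α : ℝ}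
    (hα0 : 0 ≤ α) (hα1 : α ≤ 1) (hα : α ≤ ∑ z, if T z then ρ z else 0) (K : ℕ) :
    ∑ z : Fin K → δ, (∏ k, q (z k)) * (if ∀ k, ¬ T (z k) then 1 else 0) ≤
      1 - α + Real.exp (-(K / B)) := by
  have h1 : ∑ z : Fin K → δ, (∏ k, q (z k)) * (if ∀ k, ¬ T (z k) then 1 else 0) =
      (1 - ∑ z, if T z then q z else 0) ^ K := by
    have : (1 - ∑ z, if T z then q z else 0) = ∑ z, if ¬ T z then q z else 0 := by
      rw [← hq1, ← sum_sub_distrib]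
      exact sum_congr rfl fun z _ => by by_cases h : T z <;> simp [h]
    rw [this]
    have h := sum_prod_apply (fun (_ : Fin K) z => if ¬ T z then q z else 0)
    rw [prod_const, card_univ, Fintype.card_fin] at h
    rw [← h]
    refine sum_congr rfl fun z _ => ?_
    rw [prod_ite_zero]
    simp
  rw [h1]
  refine one_sub_pow_le hα0 hα1 ?_ ?_ K
  · rw [← hq1]
    exact sum_le_sum fun z _ => by split_ifs <;> simp [hq0]
  · rw [div_le_iff₀ hB, sum_mul]
    refine hα.trans (sum_le_sum fun z _ => ?_)
    split_ifs with h
    · linarith [hρ z h]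
    · simp

/-- Random codebook: some codebook covers most source pairs, while the number of codewords
compatible with the second component is mostly controlled. -/
theorem exists_covering_codebook {ξ β γ : Type*} [Fintype ξ] [Fintype β] [Fintype γ]
    {PX : ξ → ℝ} {PXC : ξ → γ → ℝ} {PC : γ → ℝ} {PB : β → ℝ} {PBC : β → γ → ℝ}
    (hXC0 : ∀ x c, 0 ≤ PXC x c) (hX : ∀ x, ∑ c, PXC x c = PX x) (hX1 : ∑ x, PX x = 1)
    (hC : ∀ c, ∑ x, PXC x c = PC c) (hBC : ∑ b, ∑ c, PBC b c = 1)
    (hB0 : ∀ b, 0 ≤ PB b) (hBC0 : ∀ b c, 0 ≤ PBC b c)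
    {G : ξ → γ → Prop} {B₁ B₂ : ℝ} (hB₁ : 0 < B₁) (hB₂ : 0 < B₂)
    (hG : ∀ x c, G x c → PXC x c ≤ B₁ * (PX x * PC c)) {M L : ℕ} (hL : 0 < L) :
    ∃ cw : Fin M → γ, ∑ x, PX x * (if ∀ w, ¬ G x (cw w) then 1 else 0) +
        ∑ b, PB b * (if L < #{w | B₂ * (PB b * PC (cw w)) ≤ PBC b (cw w)} then 1 else 0) ≤
      (∑ x, ∑ c, if G x c then 0 else PXC x c) + Real.exp (-(M / B₁)) + M / (B₂ * L) := by
  have hX0 : ∀ x, 0 ≤ PX x := fun x => hX x ▸ sum_nonneg fun c _ => hXC0 x c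
  have hC0 : ∀ c, 0 ≤ PC c := fun c => hC c ▸ sum_nonneg fun x _ => hXC0 x c
  have hC1 : ∑ c, PC c = 1 := by
    simp_rw [← hC]
    rw [sum_comm]
    simp_rw [hX, hX1]
  have hL' : (0 : ℝ) < L := by exact_mod_cast hL
  let Q : (Fin M → γ) → ℝ := fun cw => ∏ w, PC (cw w)
  have hQ0 : ∀ cw, 0 ≤ Q cw := fun cw => prod_nonneg fun _ _ => hC0 _
  have hQ1 : ∑ cw, Q cw = 1 := by
    simp only [Q]
    rw [sum_prod_apply (fun (_ : Fin M) c => PC c)]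
    simp [hC1]
  -- Codewords are drawn independently from `PC`. Bounding the mean of the sum of the two failure
  -- probabilities gives one codebook good for both.
  refine exists_le_of_weighted_sum_le hQ0 hQ1 ?_
  simp_rw [mul_add, sum_add_distrib]
  refine add_le_add ?_ ?_
  · simp_rw [mul_sum, mul_left_comm (Q _)]
    rw [sum_comm]
    simp_rw [← mul_sum]
    have hx : ∀ x, PX x * ∑ cw, Q cw * (if ∀ w, ¬ G x (cw w) then 1 else 0) ≤
        (∑ c, if G x c then 0 else PXC x c) + PX x * Real.exp (-(M / B₁)) := by
      intro x
      rcases (hX0 x).eq_or_lt with h0 | h0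
      · rw [← h0]
        simp only [zero_mul, add_zero]
        exact sum_nonneg fun c _ => by split_ifs <;> simp [hXC0]
      have hsplit : (∑ c, if G x c then 0 else PXC x c) =
          PX x - ∑ c, if G x c then PXC x c else 0 := by
        rw [← hX x, ← sum_sub_distrib]
        exact sum_congr rfl fun c _ => by split_ifs <;> simp
      have hle : (∑ c, if G x c then PXC x c else 0) ≤ PX x := by
        rw [← hX x]
        exact sum_le_sum fun c _ => by split_ifs <;> simp [hXC0]
      have hnn : 0 ≤ ∑ c, if G x c then PXC x c else 0 :=
        sum_nonneg fun c _ => by split_ifs <;> simp [hXC0]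
      have := prob_all_miss_le hC0 hC1 (T := G x) (ρ := fun c => PXC x c / PX x) hB₁
        (fun c hc => by
          rw [div_le_iff₀ h0]
          linarith [hG x c hc])
        (α := (∑ c, if G x c then PXC x c else 0) / PX x) (by positivity)
        ((div_le_one h0).2 hle) (le_of_eq (by
          rw [sum_div]
          exact sum_congr rfl fun c _ => by split_ifs <;> simp)) M
      calc _ ≤ PX x * (1 - (∑ c, if G x c then PXC x c else 0) / PX x + Real.exp (-(M / B₁))) :=
            mul_le_mul_of_nonneg_left this h0.le
        _ = _ := by
            rw [hsplit]
            field_simp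
    refine (sum_le_sum fun x _ => hx x).trans (le_of_eq ?_)
    rw [sum_add_distrib, ← sum_mul, hX1, one_mul]
  · have hb : ∀ b, ∑ cw, Q cw * (PB b *
        (if L < #{w | B₂ * (PB b * PC (cw w)) ≤ PBC b (cw w)} then 1 else 0)) ≤
        M / (B₂ * L) * ∑ c, PBC b c := by
      intro b
      -- Markov's inequality for the number of compatible codewords; for each one, compatibility
      -- itself gives the change of measure from `PB`·`PC` to `PBC`/`B₂`.
      have h1 : ∀ cw : Fin M → γ, Q cw * (PB b *
          (if L < #{w | B₂ * (PB b * PC (cw w)) ≤ PBC b (cw w)} then 1 else 0)) ≤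
          ∑ w, Q cw * (PB b / L * if B₂ * (PB b * PC (cw w)) ≤ PBC b (cw w) then 1 else 0) := by
        intro cw
        rw [← mul_sum, ← mul_sum]
        refine mul_le_mul_of_nonneg_left ?_ (hQ0 cw)
        rw [div_mul_eq_mul_div, mul_div_assoc]
        refine mul_le_mul_of_nonneg_left ?_ (hB0 b)
        rw [sum_boole, le_div_iff₀ hL']
        split_ifs with h
        · rw [one_mul]
          exact_mod_cast h.le
        · simp
      refine (sum_le_sum fun cw _ => h1 cw).trans ?_
      rw [sum_comm]
      have h2 : ∀ w : Fin M, ∑ cw : Fin M → γ, Q cw *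
          (PB b / L * if B₂ * (PB b * PC (cw w)) ≤ PBC b (cw w) then 1 else 0) ≤
          1 / (B₂ * L) * ∑ c, PBC b c := by
        intro w
        have h3 := sum_prod_mul_apply (fun _ : Fin M => PC) (fun _ => hC1) w
          (fun c => PB b / L * if B₂ * (PB b * PC c) ≤ PBC b c then 1 else 0)
        refine h3.trans_le ?_
        rw [mul_sum]
        refine sum_le_sum fun c _ => ?_
        split_ifs with h
        · rw [mul_one, one_div, ← div_eq_inv_mul, le_div_iff₀ (by positivity)]
          calc _ = B₂ * (PB b * PC c) := by field_simp
            _ ≤ _ := h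
        · rw [mul_zero, mul_zero]
          exact mul_nonneg (by positivity) (hBC0 b c)
      refine (sum_le_sum fun w _ => h2 w).trans (le_of_eq ?_)
      rw [sum_const, card_univ, Fintype.card_fin, nsmul_eq_mul]
      ring
    simp_rw [mul_sum]
    rw [sum_comm]
    refine (sum_le_sum fun b _ => hb b).trans (le_of_eq ?_)
    rw [← mul_sum, hBC, mul_one]

/-- One-shot achievability for the cascade: a codebook of `M` codewords, and for each value of the
side information a table of `L * K` pairs (codeword, reproduction), such that the encoded tuple
lies in the target set `T` with high probability. -/
theorem exists_one_shot_code {α β γ δ : Type*} [Fintype α] [Fintype β] [Fintype γ] [Fintype δ]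
    {J : α → β → γ → δ → ℝ} (hJ0 : ∀ a b c z, 0 ≤ J a b c z)
    {PXC : α → β → γ → ℝ} (hXC : ∀ a b c, ∑ z, J a b c z = PXC a b c)
    {PX : α → β → ℝ} (hX : ∀ a b, ∑ c, PXC a b c = PX a b) (hX1 : ∑ a, ∑ b, PX a b = 1)
    {PC : γ → ℝ} (hC : ∀ c, ∑ a, ∑ b, PXC a b c = PC c)
    {PBC : β → γ → ℝ} (hBC : ∀ b c, ∑ a, PXC a b c = PBC b c)
    {PB : β → ℝ} (hB : ∀ b, ∑ a, PX a b = PB b)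
    {PBCZ : β → γ → δ → ℝ} (hBCZ : ∀ b c z, ∑ a, J a b c z = PBCZ b c z)
    {T : α → β → γ → δ → Prop} {η B₁ B₂ B₃ : ℝ}
    (hη : ∑ a, ∑ b, ∑ c, ∑ z, (if T a b c z then 0 else J a b c z) ≤ η)
    (hB₁ : 0 < B₁) (hB₂ : 0 < B₂) (hB₃ : 0 < B₃)
    (h₁ : ∀ a b c z, T a b c z → PXC a b c ≤ B₁ * (PX a b * PC c))
    (h₂ : ∀ a b c z, T a b c z → B₂ * (PB b * PC c) ≤ PBC b c)
    (h₃ : ∀ a b c z, T a b c z → J a b c z * PBC b c ≤ B₃ * (PBCZ b c z * PXC a b c))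
    {M L K : ℕ} (hM : 0 < M) (hL : 0 < L) (hK : 0 < K) {τ : ℝ} (hτ0 : 0 < τ) (hτ1 : τ < 1) :
    ∃ (cw : Fin M → γ) (tab : β → Fin L × Fin K → Fin M × δ) (enc : α → β → Fin L × Fin K),
      ∑ a, ∑ b, PX a b *
        (if T a b (cw (tab b (enc a b)).1) (tab b (enc a b)).2 then 0 else 1) ≤
      η / τ + Real.exp (-(M / B₁)) + M / (B₂ * L) + (τ + Real.exp (-(K / B₃))) := by
  have hXC0 : ∀ a b c, 0 ≤ PXC a b c := fun a b c => hXC a b c ▸ sum_nonneg fun z _ => hJ0 a b c z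
  have hX0 : ∀ a b, 0 ≤ PX a b := fun a b => hX a b ▸ sum_nonneg fun c _ => hXC0 a b c
  have hB0 : ∀ b, 0 ≤ PB b := fun b => hB b ▸ sum_nonneg fun a _ => hX0 a b
  have hBC0 : ∀ b c, 0 ≤ PBC b c := fun b c => hBC b c ▸ sum_nonneg fun a _ => hXC0 a b c
  have hBCZ0 : ∀ b c z, 0 ≤ PBCZ b c z := fun b c z => hBCZ b c z ▸ sum_nonneg fun a _ => hJ0 a b c z
  have hδ : Nonempty δ := by
    by_contra h
    rw [not_nonempty_iff] at h
    simp [← hX, ← hXC] at hX1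
  let φ : α → β → γ → ℝ := fun a b c => ∑ z, if T a b c z then 0 else J a b c z
  have hφ0 : ∀ a b c, 0 ≤ φ a b c := fun a b c =>
    sum_nonneg fun z _ => by split_ifs <;> simp [hJ0]
  -- Triples whose conditional law of z misses `T` with probability at most τ, so that a second
  -- stage can succeed. By Markov the other triples have mass at most η/τ.
  let G : α → β → γ → Prop := fun a b c => 0 < PXC a b c ∧ φ a b c ≤ τ * PXC a b c
  have hGT : ∀ a b c, G a b c → ∃ z, T a b c z := by
    intro a b c ⟨h0, h⟩
    by_contra! hno
    simp only [φ, hno, if_false, hXC] at h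
    nlinarith
  have hGprob : ∑ x : α × β, ∑ c, (if G x.1 x.2 c then 0 else PXC x.1 x.2 c) ≤ η / τ := by
    rw [Fintype.sum_prod_type, le_div_iff₀ hτ0]
    refine le_trans ?_ hη
    simp_rw [sum_mul]
    refine sum_le_sum fun a _ => sum_le_sum fun b _ => sum_le_sum fun c _ => ?_
    change _ ≤ φ a b c
    split_ifs with h
    · simpa using hφ0 a b c
    · rcases (hXC0 a b c).eq_or_lt with h0 | h0
      · rw [← h0]
        simpa using hφ0 a b c
      · by_contra! hlt
        exact h ⟨h0, by linarith⟩
  obtain ⟨cw, hcw⟩ := exists_covering_codebook (ξ := α × β) (β := β) (PX := fun x => PX x.1 x.2)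
    (PXC := fun x c => PXC x.1 x.2 c) (PC := PC) (PB := PB) (PBC := PBC)
    (fun x c => hXC0 _ _ c) (fun x => hX _ _)
    (by rw [Fintype.sum_prod_type]; exact hX1) (fun c => by rw [Fintype.sum_prod_type]; exact hC c)
    (by
      rw [← hX1, sum_comm (f := fun a b => PX a b)]
      refine sum_congr rfl fun b _ => ?_
      simp_rw [← hBC, ← hX]
      rw [sum_comm])
    hB0 hBC0 (G := fun x c => G x.1 x.2 c) hB₁ hB₂
    (fun x c hc => by
      obtain ⟨z, hz⟩ := hGT _ _ _ hc
      exact h₁ _ _ _ _ hz) (M := M) hL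
  -- the codeword used for a source pair
  let wsel : α → β → Fin M := fun a b =>
    if h : ∃ w, G a b (cw w) then h.choose else ⟨0, hM⟩
  have hwsel : ∀ a b, (∃ w, G a b (cw w)) → G a b (cw (wsel a b)) := by
    intro a b h
    simp only [wsel, dif_pos h]
    exact h.choose_spec
  -- the second-stage codebooks
  have hstage : ∀ b w, ∃ zw : Fin K → δ,
      ∑ a, (if G a b (cw w) ∧ wsel a b = w then PX a b else 0) *
        (if ∀ k, ¬ T a b (cw w) (zw k) then 1 else 0) ≤
      ∑ a, (if G a b (cw w) ∧ wsel a b = w then PX a b else 0) *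
        (τ + Real.exp (-(K / B₃))) := by
    intro b w
    by_cases hex : ∃ a, G a b (cw w)
    swap
    · push Not at hex
      exact ⟨fun _ => Classical.arbitrary δ, by simp [hex]⟩
    obtain ⟨a₀, ha₀⟩ := hex
    have hpos : 0 < PBC b (cw w) := by
      rw [← hBC]
      exact ha₀.1.trans_le (single_le_sum (f := fun a => PXC a b (cw w))
        (fun a _ => hXC0 a b (cw w)) (mem_univ a₀))
    -- Node 2 does not know a, so z is drawn given (b,c) only; `h₃` bounds the price of this
    -- mismatch by `B₃`.
    let r : δ → ℝ := fun z => PBCZ b (cw w) z / PBC b (cw w)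
    have hr0 : ∀ z, 0 ≤ r z := fun z => div_nonneg (hBCZ0 _ _ _) hpos.le
    have hr1 : ∑ z, r z = 1 := by
      simp only [r]
      rw [← sum_div, div_eq_one_iff_eq hpos.ne', ← hBC]
      simp_rw [← hBCZ, ← hXC]
      rw [sum_comm]
    have hQ1 : ∑ z : Fin K → δ, ∏ k, r (z k) = 1 := by
      rw [sum_prod_apply (fun (_ : Fin K) z => r z)]
      simp [hr1]
    refine exists_le_of_weighted_sum_le (q := fun z : Fin K → δ => ∏ k, r (z k))
      (fun z => prod_nonneg fun _ _ => hr0 _) hQ1 ?_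
    simp_rw [mul_sum, mul_left_comm (∏ k, r _)]
    rw [sum_comm]
    refine sum_le_sum fun a _ => ?_
    rw [← mul_sum]
    split_ifs with h
    · refine mul_le_mul_of_nonneg_left ?_ (hX0 a b)
      obtain ⟨⟨hxc, hφ⟩, -⟩ := h
      have := prob_all_miss_le hr0 hr1 (T := T a b (cw w))
        (ρ := fun z => J a b (cw w) z / PXC a b (cw w)) hB₃ (fun z hz => by
          have := h₃ a b (cw w) z hz
          simp only [r]
          rw [div_le_iff₀ hxc, mul_div_assoc', div_mul_eq_mul_div, le_div_iff₀ hpos]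
          linarith) (α := 1 - τ) (by linarith) (by linarith) (by
          have h4 : (∑ z, if T a b (cw w) z then J a b (cw w) z / PXC a b (cw w) else 0) =
              (PXC a b (cw w) - φ a b (cw w)) / PXC a b (cw w) := by
            simp only [φ]
            rw [← hXC, ← sum_sub_distrib, sum_div]
            exact sum_congr rfl fun z _ => by split_ifs <;> simp
          rw [h4, le_div_iff₀ hxc]
          linarith) K
      linarith
    · simp
  choose zw hzw using hstage
  -- the lists of codewords compatible with the side information
  have hlist : ∀ b, ∃ lst : Fin L → Fin M,
      #{w | B₂ * (PB b * PC (cw w)) ≤ PBC b (cw w)} ≤ L →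
      ∀ w, B₂ * (PB b * PC (cw w)) ≤ PBC b (cw w) → ∃ l, lst l = w := by
    intro b
    set S : Finset (Fin M) := {w | B₂ * (PB b * PC (cw w)) ≤ PBC b (cw w)} with hS
    -- Positions beyond the size of `S` hold an arbitrary codeword.
    refine ⟨fun l => if h : l.val < #S then (S.equivFin.symm ⟨l.val, h⟩ : S) else ⟨0, hM⟩,
      fun hcard w hw => ?_⟩
    have hwS : w ∈ S := by simpa [hS] using hw
    refine ⟨⟨S.equivFin ⟨w, hwS⟩, (Fin.is_lt _).trans_le hcard⟩, ?_⟩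
    simp
  choose lst hlst using hlist
  let tab : β → Fin L × Fin K → Fin M × δ := fun b l => (lst b l.1, zw b (lst b l.1) l.2)
  let enc : α → β → Fin L × Fin K := fun a b =>
    if h : ∃ l, T a b (cw (tab b l).1) (tab b l).2 then h.choose else (⟨0, hL⟩, ⟨0, hK⟩)
  refine ⟨cw, tab, enc, ?_⟩
  -- Three causes of failure: no good codeword, too many codewords compatible with b, or all K
  -- reproductions of the selected codeword missing `T`.
  have hfail : ∀ a b, PX a b *
      (if T a b (cw (tab b (enc a b)).1) (tab b (enc a b)).2 then 0 else 1) ≤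
      PX a b * (if ∀ w, ¬ G a b (cw w) then 1 else 0) +
      PX a b * (if L < #{w | B₂ * (PB b * PC (cw w)) ≤ PBC b (cw w)} then 1 else 0) +
      ∑ w, (if G a b (cw w) ∧ wsel a b = w then PX a b else 0) *
        (if ∀ k, ¬ T a b (cw w) (zw b w k) then 1 else 0) := by
    intro a b
    have hlast : 0 ≤ ∑ w, (if G a b (cw w) ∧ wsel a b = w then PX a b else 0) *
        (if ∀ k, ¬ T a b (cw w) (zw b w k) then (1 : ℝ) else 0) :=
      sum_nonneg fun w _ => by
        refine mul_nonneg ?_ ?_ <;> split_ifs <;> simp [hX0]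
    have hsecond : 0 ≤ PX a b *
        (if L < #{w | B₂ * (PB b * PC (cw w)) ≤ PBC b (cw w)} then (1 : ℝ) else 0) :=
      mul_nonneg (hX0 a b) (by split_ifs <;> norm_num)
    have hfirst : 0 ≤ PX a b * (if ∀ w, ¬ G a b (cw w) then (1 : ℝ) else 0) :=
      mul_nonneg (hX0 a b) (by split_ifs <;> norm_num)
    by_cases hT : T a b (cw (tab b (enc a b)).1) (tab b (enc a b)).2
    · rw [if_pos hT]
      linarith
    rw [if_neg hT, mul_one]
    by_cases hno : ∀ w, ¬ G a b (cw w)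
    · rw [if_pos hno, mul_one]
      linarith
    by_cases hbig : L < #{w | B₂ * (PB b * PC (cw w)) ≤ PBC b (cw w)}
    · rw [if_pos hbig, mul_one]
      linarith
    push Not at hno hbig
    have hGw := hwsel a b hno
    obtain ⟨z₀, hz₀⟩ := hGT _ _ _ hGw
    obtain ⟨l, hl⟩ := hlst b hbig (wsel a b) (h₂ _ _ _ _ hz₀)
    have hmiss : ∀ k, ¬ T a b (cw (wsel a b)) (zw b (wsel a b) k) := by
      intro k hk
      have hexl : ∃ l, T a b (cw (tab b l).1) (tab b l).2 := ⟨(l, k), by simpa [tab, hl] using hk⟩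
      apply hT
      have : enc a b = hexl.choose := dif_pos hexl
      rw [this]
      exact hexl.choose_spec
    have hterm : PX a b ≤ ∑ w, (if G a b (cw w) ∧ wsel a b = w then PX a b else 0) *
        (if ∀ k, ¬ T a b (cw w) (zw b w k) then (1 : ℝ) else 0) := by
      rw [sum_eq_single (wsel a b)]
      · rw [if_pos ⟨hGw, rfl⟩, if_pos hmiss, mul_one]
      · intro w _ hw
        rw [if_neg fun h => hw h.2.symm, zero_mul]
      · simp
    linarith
  refine (sum_le_sum fun a _ => sum_le_sum fun b _ => hfail a b).trans ?_
  simp_rw [sum_add_distrib]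
  rw [Fintype.sum_prod_type] at hcw
  have e2 : ∑ a, ∑ b, PX a b *
      (if L < #{w | B₂ * (PB b * PC (cw w)) ≤ PBC b (cw w)} then (1 : ℝ) else 0) =
      ∑ b, PB b * (if L < #{w | B₂ * (PB b * PC (cw w)) ≤ PBC b (cw w)} then 1 else 0) := by
    rw [sum_comm]
    refine sum_congr rfl fun b _ => ?_
    rw [← sum_mul, hB]
  have e3 : ∑ a, ∑ b, ∑ w, (if G a b (cw w) ∧ wsel a b = w then PX a b else 0) *
      (if ∀ k, ¬ T a b (cw w) (zw b w k) then (1 : ℝ) else 0) ≤ τ + Real.exp (-(K / B₃)) := by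
    rw [sum_comm]
    simp_rw [sum_comm (s := univ (α := α))]
    have hc : 0 ≤ τ + Real.exp (-(K / B₃)) := by positivity
    calc _ ≤ ∑ b, ∑ w, ∑ a, (if G a b (cw w) ∧ wsel a b = w then PX a b else 0) *
          (τ + Real.exp (-(K / B₃))) := sum_le_sum fun b _ => sum_le_sum fun w _ => hzw b w
      -- Each source pair selects a single codeword, so the weights summed over w are at most `PX a
      -- b`.
      _ ≤ ∑ b, ∑ a, PX a b * (τ + Real.exp (-(K / B₃))) := by
          refine sum_le_sum fun b _ => ?_
          rw [sum_comm]
          refine sum_le_sum fun a _ => ?_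
          rw [← sum_mul]
          refine mul_le_mul_of_nonneg_right ?_ hc
          rw [sum_eq_single (wsel a b)]
          · split_ifs <;> simp [hX0]
          · intro w _ hw
            exact if_neg fun h => hw h.2.symm
          · simp
      _ = _ := by
          simp_rw [← sum_mul]
          rw [sum_comm, hX1, one_mul]
  rw [e2]
  refine add_le_add ?_ e3
  convert hcw.trans (add_le_add (add_le_add (le_of_eq_of_le ?_ hGprob) le_rfl) le_rfl)
  congr!

end OneShot

/-! ### Chernoff bound and weak law of large numbers. -/

section LargeDeviations

open scoped Classical
open Finset Filter Topology

/-- Chernoff bound for finite alphabets. -/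
theorem exists_chernoff_rate {S : Type*} [Fintype S] {p : S → ℝ} (hp0 : ∀ s, 0 ≤ p s)
    (hp1 : ∑ s, p s = 1) (f : S → ℝ) {μ : ℝ} (hμ : ∑ s, p s * f s < μ) :
    ∃ ρ : ℝ, 0 ≤ ρ ∧ ρ < 1 ∧ ∀ n : ℕ, ∑ s : Fin n → S, (∏ i, p (s i)) *
      (if ∑ i, f (s i) ≤ n * μ then 0 else 1) ≤ ρ ^ n := by
  obtain ⟨B, hB1, hB⟩ : ∃ B : ℝ, 1 ≤ B ∧ ∀ s, |f s - μ| ≤ B := by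
    refine ⟨1 + ∑ s, |f s - μ|, by linarith [sum_nonneg fun s (_ : s ∈ univ) => abs_nonneg (f s - μ)],
      fun s => ?_⟩
    have := single_le_sum (f := fun s => |f s - μ|) (fun s _ => abs_nonneg _) (mem_univ s)
    linarith
  set d := μ - ∑ s, p s * f s with hd
  have hd0 : 0 < d := sub_pos.2 hμ
  have hE : ∑ s, p s * (f s - μ) = -d := by
    simp_rw [mul_sub, sum_sub_distrib, ← sum_mul, hp1]
    linarith
  -- The first bound allows e^x ≤ 1 + x + x²; the second keeps the quadratic term below td/2, half
  -- of the linear gain td. The exponential moment is then at most 1 - td/2.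
  set t := min (1 / B) (d / (2 * B ^ 2)) with ht
  have hB0 : 0 < B := by linarith
  have ht0 : 0 < t := lt_min (by positivity) (by positivity)
  have htB : t * B ≤ 1 := by
    have := min_le_left (1 / B) (d / (2 * B ^ 2))
    rwa [← ht, le_div_iff₀ hB0] at this
  have htd : t * B ^ 2 ≤ d / 2 := by
    have := min_le_right (1 / B) (d / (2 * B ^ 2))
    rw [← ht, le_div_iff₀ (by positivity)] at this
    linarith
  refine ⟨∑ s, p s * Real.exp (t * (f s - μ)),
    sum_nonneg fun s _ => mul_nonneg (hp0 s) (Real.exp_pos _).le, ?_, fun n => ?_⟩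
  · have h1 : ∀ s, p s * Real.exp (t * (f s - μ)) ≤
        p s + t * (p s * (f s - μ)) + p s * (t ^ 2 * B ^ 2) := by
      intro s
      have habs : |t * (f s - μ)| ≤ t * B := by
        rw [abs_mul, abs_of_pos ht0]
        exact mul_le_mul_of_nonneg_left (hB s) ht0.le
      have h2 := (abs_le.1 (Real.abs_exp_sub_one_sub_id_le (habs.trans htB))).2
      have h3 : (t * (f s - μ)) ^ 2 ≤ t ^ 2 * B ^ 2 := by
        rw [← sq_abs, ← mul_pow]
        exact pow_le_pow_left₀ (abs_nonneg _) habs 2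
      calc _ ≤ p s * (1 + t * (f s - μ) + t ^ 2 * B ^ 2) :=
            mul_le_mul_of_nonneg_left (by linarith) (hp0 s)
        _ = _ := by ring
    refine (sum_le_sum fun s _ => h1 s).trans_lt ?_
    rw [sum_add_distrib, sum_add_distrib, hp1, ← mul_sum, hE, ← sum_mul, hp1]
    nlinarith
  · have h := sum_prod_apply (fun (_ : Fin n) s => p s * Real.exp (t * (f s - μ)))
    rw [prod_const, card_univ, Fintype.card_fin] at h
    rw [← h]
    refine sum_le_sum fun s _ => ?_
    rw [prod_mul_distrib, ← Real.exp_sum, ← mul_sum, sum_sub_distrib, sum_const, card_univ,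
      Fintype.card_fin, nsmul_eq_mul]
    refine mul_le_mul_of_nonneg_left ?_ (prod_nonneg fun _ _ => hp0 _)
    split_ifs with hle
    · exact (Real.exp_pos _).le
    · rw [← Real.exp_zero, Real.exp_le_exp]
      push Not at hle
      exact mul_nonneg ht0.le (by linarith)

/-- Simultaneous weak law of large numbers for finitely many functions on a finite alphabet. -/
theorem tendsto_prob_exceed {S κ : Type*} [Fintype S] [Fintype κ] {p : S → ℝ}
    (hp0 : ∀ s, 0 ≤ p s) (hp1 : ∑ s, p s = 1) (f : κ → S → ℝ) {μ : κ → ℝ}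
    (hμ : ∀ l, ∑ s, p s * f l s < μ l) :
    Tendsto (fun n : ℕ => ∑ s : Fin n → S, (∏ i, p (s i)) *
      (if ∀ l, ∑ i, f l (s i) ≤ n * μ l then 0 else 1)) atTop (𝓝 0) := by
  choose ρ hρ0 hρ1 hρ using fun l => exists_chernoff_rate hp0 hp1 (f l) (hμ l)
  have hlim : Tendsto (fun n : ℕ => ∑ l, ρ l ^ n) atTop (𝓝 0) := by
    have := tendsto_finsetSum (univ : Finset κ) fun l _ =>
      tendsto_pow_atTop_nhds_zero_of_lt_one (hρ0 l) (hρ1 l)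
    simpa using this
  refine squeeze_zero (fun n => sum_nonneg fun s _ => mul_nonneg (prod_nonneg fun _ _ => hp0 _)
    (by split_ifs <;> norm_num)) (fun n => ?_) hlim
  refine le_trans ?_ (sum_le_sum fun l _ => hρ l n)
  rw [sum_comm]
  refine sum_le_sum fun s _ => ?_
  rw [← mul_sum]
  refine mul_le_mul_of_nonneg_left ?_ (prod_nonneg fun _ _ => hp0 _)
  have hnn : ∀ l, (0 : ℝ) ≤ if ∑ i, f l (s i) ≤ n * μ l then 0 else 1 := fun l => by
    split_ifs <;> norm_num
  split_ifs with h
  · exact sum_nonneg fun l _ => hnn l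
  · push Not at h
    obtain ⟨l, hl⟩ := h
    have := single_le_sum (f := fun l => if ∑ i, f l (s i) ≤ n * μ l then (0 : ℝ) else 1)
      (fun l _ => hnn l) (mem_univ l)
    simpa [not_le.2 hl] using this

end LargeDeviations

/-! ### Marginals of block laws. -/

section BlockMarginals

open scoped Classical
open Finset

theorem sum_pi_prod {ι α β : Type*} [Fintype ι] [DecidableEq ι] [Fintype α] [Fintype β]
    (F : (ι → α × β) → ℝ) :
    ∑ s, F s = ∑ a : ι → α, ∑ b : ι → β, F (fun i => (a i, b i)) := by
  rw [← (Equiv.arrowProdEquivProdArrow ι (fun _ => α) (fun _ => β)).symm.sum_comp,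
    Fintype.sum_prod_type]
  rfl

/-- Marginalization, with the fibre over `w` parametrized by `e`. -/
theorem sum_lawOf_fiber {Ω κ α β : Type*} [Fintype Ω] [Fintype κ] (p : Ω → ℝ) {V : Ω → α}
    {W : Ω → β} {e : κ → α} (he : Function.Injective e) {w : β}
    (h : ∀ ω, W ω = w ↔ ∃ k, V ω = e k) : ∑ k, lawOf p V (e k) = lawOf p W w := by
  simp_rw [lawOf_eq_sum_ite]
  rw [sum_comm]
  refine sum_congr rfl fun ω _ => ?_
  by_cases hw : W ω = w
  · obtain ⟨k, hk⟩ := (h ω).1 hw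
    rw [if_pos hw, sum_eq_single k]
    · rw [if_pos hk]
    · intro k' _ hk'
      exact if_neg fun h' => hk' (he (h'.symm.trans hk))
    · simp
  · rw [if_neg hw]
    exact sum_eq_zero fun k _ => if_neg fun h' => hw ((h ω).2 ⟨k, h'⟩)

theorem prod_le_two_rpow {ι : Type*} [Fintype ι] {r : ι → ℝ} (hr : ∀ i, 0 < r i) {t : ℝ}
    (h : ∑ i, Real.logb 2 (r i) ≤ t) : ∏ i, r i ≤ (2 : ℝ) ^ t := by
  rw [← Real.logb_prod _ _ fun i _ => (hr i).ne'] at h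
  exact (Real.logb_le_iff_le_rpow one_lt_two (prod_pos fun i _ => hr i)).1 h

end BlockMarginals

/-! ### Information densities and their means. -/

section InformationDensities

open scoped Classical
open Finset

variable {α β γ δ : Type*} [Fintype α] [Fintype β] [Fintype γ] [Fintype δ]

theorem sum_mul_logb_lawOf {Ω : Type*} [Fintype Ω] (p : Ω → ℝ) (X : Ω → α) :
    ∑ ω, p ω * Real.logb 2 (lawOf p X (X ω)) = -entropy p X := by
  rw [entropy_eq_expect, neg_neg]

variable (p : α × β × γ × δ → ℝ)

/-- Information density of `(α, β)` and `γ`. -/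
noncomputable def density₁ (s : α × β × γ × δ) : ℝ :=
  lawOf p (fun s => (s.1, s.2.1, s.2.2.1)) (s.1, s.2.1, s.2.2.1) /
    (lawOf p (fun s => (s.1, s.2.1)) (s.1, s.2.1) * lawOf p (fun s => s.2.2.1) s.2.2.1)

/-- Inverse information density of `β` and `γ`. -/
noncomputable def density₂ (s : α × β × γ × δ) : ℝ :=
  lawOf p (fun s => s.2.1) s.2.1 * lawOf p (fun s => s.2.2.1) s.2.2.1 /
    lawOf p (fun s => (s.2.1, s.2.2.1)) (s.2.1, s.2.2.1)

/-- Conditional information density of `α` and `δ` given `(β, γ)`. -/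
noncomputable def density₃ (s : α × β × γ × δ) : ℝ :=
  p s * lawOf p (fun s => (s.2.1, s.2.2.1)) (s.2.1, s.2.2.1) /
    (lawOf p (fun s => (s.2.1, s.2.2.1, s.2.2.2)) (s.2.1, s.2.2.1, s.2.2.2) *
      lawOf p (fun s => (s.1, s.2.1, s.2.2.1)) (s.1, s.2.1, s.2.2.1))

variable {p} (hp : ∀ s, 0 ≤ p s)
include hp

theorem density₁_pos {s : α × β × γ × δ} (hs : 0 < p s) : 0 < density₁ p s :=
  div_pos (lawOf_pos hp (fun s => (s.1, s.2.1, s.2.2.1)) hs)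
    (mul_pos (lawOf_pos hp (fun s => (s.1, s.2.1)) hs) (lawOf_pos hp (fun s => s.2.2.1) hs))

theorem density₂_pos {s : α × β × γ × δ} (hs : 0 < p s) : 0 < density₂ p s :=
  div_pos (mul_pos (lawOf_pos hp (fun s => s.2.1) hs) (lawOf_pos hp (fun s => s.2.2.1) hs))
    (lawOf_pos hp (fun s => (s.2.1, s.2.2.1)) hs)

theorem density₃_pos {s : α × β × γ × δ} (hs : 0 < p s) : 0 < density₃ p s :=
  div_pos (mul_pos hs (lawOf_pos hp (fun s => (s.2.1, s.2.2.1)) hs))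
    (mul_pos (lawOf_pos hp (fun s => (s.2.1, s.2.2.1, s.2.2.2)) hs)
      (lawOf_pos hp (fun s => (s.1, s.2.1, s.2.2.1)) hs))

theorem expect_density₁ : ∑ s, p s * Real.logb 2 (density₁ p s) =
    entropy p (fun s => (s.1, s.2.1)) + entropy p (fun s => s.2.2.1) -
      entropy p (fun s => (s.1, s.2.1, s.2.2.1)) := by
  have h : ∀ s, p s * Real.logb 2 (density₁ p s) =
      p s * Real.logb 2 (lawOf p (fun s => (s.1, s.2.1, s.2.2.1)) (s.1, s.2.1, s.2.2.1)) -
      p s * Real.logb 2 (lawOf p (fun s => (s.1, s.2.1)) (s.1, s.2.1)) -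
      p s * Real.logb 2 (lawOf p (fun s => s.2.2.1) s.2.2.1) := by
    intro s
    rcases (hp s).eq_or_lt with h0 | h0
    · simp [← h0]
    · have h1 := lawOf_pos hp (fun s => (s.1, s.2.1, s.2.2.1)) h0
      have h2 := lawOf_pos hp (fun s => (s.1, s.2.1)) h0
      have h3 := lawOf_pos hp (fun s => s.2.2.1) h0
      rw [density₁, Real.logb_div h1.ne' (mul_pos h2 h3).ne', Real.logb_mul h2.ne' h3.ne']
      ring
  simp_rw [h, sum_sub_distrib]
  rw [sum_mul_logb_lawOf p (fun s => (s.1, s.2.1, s.2.2.1)),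
    sum_mul_logb_lawOf p (fun s => (s.1, s.2.1)), sum_mul_logb_lawOf p (fun s => s.2.2.1)]
  ring

theorem expect_density₂ : ∑ s, p s * Real.logb 2 (density₂ p s) =
    entropy p (fun s => (s.2.1, s.2.2.1)) - entropy p (fun s => s.2.1) -
      entropy p (fun s => s.2.2.1) := by
  have h : ∀ s, p s * Real.logb 2 (density₂ p s) =
      p s * Real.logb 2 (lawOf p (fun s => s.2.1) s.2.1) +
      p s * Real.logb 2 (lawOf p (fun s => s.2.2.1) s.2.2.1) -
      p s * Real.logb 2 (lawOf p (fun s => (s.2.1, s.2.2.1)) (s.2.1, s.2.2.1)) := by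
    intro s
    rcases (hp s).eq_or_lt with h0 | h0
    · simp [← h0]
    · have h1 := lawOf_pos hp (fun s => (s.2.1, s.2.2.1)) h0
      have h2 := lawOf_pos hp (fun s => s.2.1) h0
      have h3 := lawOf_pos hp (fun s => s.2.2.1) h0
      rw [density₂, Real.logb_div (mul_pos h2 h3).ne' h1.ne', Real.logb_mul h2.ne' h3.ne']
      ring
  simp_rw [h, sum_sub_distrib, sum_add_distrib]
  rw [sum_mul_logb_lawOf p (fun s => (s.2.1, s.2.2.1)), sum_mul_logb_lawOf p (fun s => s.2.1),
    sum_mul_logb_lawOf p (fun s => s.2.2.1)]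
  ring

theorem expect_density₃ : ∑ s, p s * Real.logb 2 (density₃ p s) =
    entropy p (fun s => (s.2.1, s.2.2.1, s.2.2.2)) + entropy p (fun s => (s.1, s.2.1, s.2.2.1)) -
      entropy p (fun s => s) - entropy p (fun s => (s.2.1, s.2.2.1)) := by
  have h : ∀ s, p s * Real.logb 2 (density₃ p s) =
      p s * Real.logb 2 (lawOf p (fun s => s) s) +
      p s * Real.logb 2 (lawOf p (fun s => (s.2.1, s.2.2.1)) (s.2.1, s.2.2.1)) -
      p s * Real.logb 2 (lawOf p (fun s => (s.2.1, s.2.2.1, s.2.2.2)) (s.2.1, s.2.2.1, s.2.2.2)) -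
      p s * Real.logb 2 (lawOf p (fun s => (s.1, s.2.1, s.2.2.1)) (s.1, s.2.1, s.2.2.1)) := by
    intro s
    rcases (hp s).eq_or_lt with h0 | h0
    · simp [← h0]
    · have h1 := lawOf_pos hp (fun s => (s.2.1, s.2.2.1)) h0
      have h2 := lawOf_pos hp (fun s => (s.2.1, s.2.2.1, s.2.2.2)) h0
      have h3 := lawOf_pos hp (fun s => (s.1, s.2.1, s.2.2.1)) h0
      rw [density₃, lawOf_id, Real.logb_div (mul_pos h0 h1).ne' (mul_pos h2 h3).ne',
        Real.logb_mul h0.ne' h1.ne', Real.logb_mul h2.ne' h3.ne']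
      ring
  simp_rw [h, sum_sub_distrib, sum_add_distrib]
  rw [sum_mul_logb_lawOf p (fun s => s), sum_mul_logb_lawOf p (fun s => (s.2.1, s.2.2.1)),
    sum_mul_logb_lawOf p (fun s => (s.2.1, s.2.2.1, s.2.2.2)),
    sum_mul_logb_lawOf p (fun s => (s.1, s.2.1, s.2.2.1))]
  ring

theorem expect_density₁_eq_mutualInfo : ∑ s, p s * Real.logb 2 (density₁ p s) =
    mutualInfo p (fun s => (s.1, s.2.1)) (fun s => s.2.2.1) := by
  rw [expect_density₁ hp, mutualInfo, condEntropy_eq_sub hp,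
    entropy_congr_ker p (X := fun s => ((s.1, s.2.1), s.2.2.1))
      (Y := fun s => (s.1, s.2.1, s.2.2.1)) (fun _ _ => by simp [and_assoc])]
  ring

/-- I(X₁,X₂;C) - I(X₂;C) = I(X₁;C|X₂), the exponent of the list size, and adding I(X₁;Z|X₂,C), the
exponent of the table size, gives the rate from Node 1 to Node 2. -/
theorem expect_densities_eq_condMutualInfo : ∑ s, p s * Real.logb 2 (density₁ p s) +
    ∑ s, p s * Real.logb 2 (density₂ p s) + ∑ s, p s * Real.logb 2 (density₃ p s) =
    condMutualInfo p (fun s => s.1) (fun s => (s.2.2.1, s.2.2.2)) (fun s => s.2.1) := by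
  rw [expect_density₁ hp, expect_density₂ hp, expect_density₃ hp, condMutualInfo,
    condEntropy_eq_sub hp, condEntropy_eq_sub hp,
    entropy_congr_ker p (X := fun s => (s.1, (s.2.2.1, s.2.2.2), s.2.1)) (Y := fun s => s)
      (fun _ _ => by simp only [Prod.ext_iff]; tauto),
    entropy_congr_ker p (X := fun s => ((s.2.2.1, s.2.2.2), s.2.1))
      (Y := fun s => (s.2.1, s.2.2.1, s.2.2.2)) (fun _ _ => by simp only [Prod.ext_iff]; tauto)]
  ring

theorem expect_density₁_nonneg (h1 : ∑ s, p s = 1) :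
    0 ≤ ∑ s, p s * Real.logb 2 (density₁ p s) := by
  rw [expect_density₁_eq_mutualInfo hp, mutualInfo, sub_nonneg]
  exact condEntropy_le_entropy hp h1 _ _

/-- The sum is I(X₁;C|X₂). Nonnegative exponents ensure that rounding codebook sizes up costs at
most a factor 2. -/
theorem expect_density₁₂_nonneg :
    0 ≤ ∑ s, p s * Real.logb 2 (density₁ p s) + ∑ s, p s * Real.logb 2 (density₂ p s) := by
  have h := condEntropy_le_comp hp (fun s => s.1) (fun s => (s.2.1, s.2.2.1)) Prod.fst
  rw [condEntropy_eq_sub hp, condEntropy_eq_sub hp] at h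
  rw [expect_density₁ hp, expect_density₂ hp]
  linarith

theorem expect_density₃_nonneg : 0 ≤ ∑ s, p s * Real.logb 2 (density₃ p s) := by
  have h := condEntropy_le_comp hp (fun s => s.1) (fun s => (s.2.1, s.2.2.1, s.2.2.2))
    (fun t => (t.1, t.2.1))
  rw [condEntropy_eq_sub hp, condEntropy_eq_sub hp] at h
  rw [expect_density₃ hp]
  have e : entropy p (fun s => (s.1, s.2.1, s.2.2.1, s.2.2.2)) = entropy p (fun s => s) := rfl
  linarith

end InformationDensities

/-! ### The one-shot code applied to i.i.d. blocks. -/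

section BlockCode

open scoped Classical
open Finset Filter Topology

theorem nat_ceil_le_two_mul {x : ℝ} (hx : 1 ≤ x) : (⌈x⌉₊ : ℝ) ≤ 2 * x := by
  have := Nat.ceil_lt_add_one (by linarith : 0 ≤ x)
  linarith

theorem exists_fin_surjective {κ : Type*} [Fintype κ] [Nonempty κ] {m : ℕ}
    (h : Fintype.card κ ≤ m) : ∃ f : Fin m → κ, Function.Surjective f := by
  obtain ⟨e⟩ := Function.Embedding.nonempty_of_card_le (α := κ) (β := Fin m) (by simpa using h)
  exact ⟨Function.invFun e, Function.invFun_surjective e.injective⟩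

/-- The information densities and the additional test functions `g` of a single letter. -/
noncomputable def letterTests {α β γ δ κ : Type*} [Fintype α] [Fintype β] [Fintype γ] [Fintype δ]
    (p : α × β × γ × δ → ℝ) (g : κ → α × β × γ × δ → ℝ) : Fin 3 ⊕ κ → α × β × γ × δ → ℝ :=
  Sum.elim ![fun s => Real.logb 2 (density₁ p s), fun s => Real.logb 2 (density₂ p s),
    fun s => Real.logb 2 (density₃ p s)] g

/-- The one-shot code for blocks of independent letters. -/
theorem exists_block_code_of_sizes {α β γ δ κ : Type*} [Fintype α] [Fintype β] [Fintype γ]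
    [Fintype δ] [Fintype κ] {p : α × β × γ × δ → ℝ} (hp0 : ∀ s, 0 ≤ p s) (hp1 : ∑ s, p s = 1)
    (g : κ → α × β × γ × δ → ℝ) (ν : Fin 3 ⊕ κ → ℝ) (n : ℕ) {M L K : ℕ} (hM0 : 0 < M) (hL0 : 0 < L)
    (hK0 : 0 < K) {τ : ℝ} (hτ0 : 0 < τ) (hτ1 : τ < 1) :
    ∃ (cw : Fin M → Fin n → γ) (tab : (Fin n → β) → Fin L × Fin K → Fin M × (Fin n → δ))
      (enc : (Fin n → α) → (Fin n → β) → Fin L × Fin K),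
      ∑ a : Fin n → α, ∑ b : Fin n → β,
        (∏ i, lawOf p (fun s => (s.1, s.2.1)) (a i, b i)) *
        (if ∀ l, ∑ i, g l (a i, b i, cw (tab b (enc a b)).1 i, (tab b (enc a b)).2 i) ≤
          n * ν (Sum.inr l) then 0 else 1) ≤
      (∑ s : Fin n → α × β × γ × δ, (∏ i, p (s i)) *
        (if ∀ l, ∑ i, letterTests p g l (s i) ≤ n * ν l then 0 else 1)) / τ +
      Real.exp (-(M / 2 ^ (n * ν (Sum.inl 0)))) +
      M / (2 ^ (n * -ν (Sum.inl 1)) * L) +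
      (τ + Real.exp (-(K / 2 ^ (n * ν (Sum.inl 2))))) := by
  have hpos : ∀ x : ℝ, 0 < (2 : ℝ) ^ (n * x) := fun x => Real.rpow_pos_of_pos two_pos _
  let J : (Fin n → α) → (Fin n → β) → (Fin n → γ) → (Fin n → δ) → ℝ := fun a b c z =>
    ∏ i, p (a i, b i, c i, z i)
  -- Positivity of every letter is required so that the logarithms of the densities are meaningful;
  -- the blocks it excludes have mass zero.
  obtain ⟨T, hTiff⟩ : ∃ T : (Fin n → α) → (Fin n → β) → (Fin n → γ) → (Fin n → δ) → Prop,
      ∀ a b c z, T a b c z ↔ (∀ i, 0 < p (a i, b i, c i, z i)) ∧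
        ∀ l, ∑ i, letterTests p g l (a i, b i, c i, z i) ≤ n * ν l :=
    ⟨_, fun _ _ _ _ => Iff.rfl⟩
  have hTpos : ∀ {a b c z}, T a b c z → ∀ i, 0 < p (a i, b i, c i, z i) :=
    fun hT => ((hTiff _ _ _ _).1 hT).1
  have hTle : ∀ {a b c z}, T a b c z → ∀ l, ∑ i, letterTests p g l (a i, b i, c i, z i) ≤ n * ν l :=
    fun hT => ((hTiff _ _ _ _).1 hT).2
  have hJη : ∑ a, ∑ b, ∑ c, ∑ z, (if T a b c z then 0 else J a b c z) ≤
      ∑ s : Fin n → α × β × γ × δ, (∏ i, p (s i)) *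
        (if ∀ l, ∑ i, letterTests p g l (s i) ≤ n * ν l then 0 else 1) := by
    rw [sum_pi_prod]
    simp_rw [sum_pi_prod]
    refine sum_le_sum fun a _ => sum_le_sum fun b _ => sum_le_sum fun c _ =>
      sum_le_sum fun z _ => ?_
    have hJ0 : 0 ≤ J a b c z := prod_nonneg fun _ _ => hp0 _
    by_cases hT : T a b c z
    · rw [if_pos hT]
      exact mul_nonneg hJ0 (by split_ifs <;> norm_num)
    · rw [if_neg hT]
      by_cases hall : ∀ i, 0 < p (a i, b i, c i, z i)
      · rw [if_neg fun h => hT ((hTiff _ _ _ _).2 ⟨hall, h⟩), mul_one]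
      · push Not at hall
        obtain ⟨i, hi⟩ := hall
        have hz : J a b c z = 0 := prod_eq_zero (mem_univ i) (le_antisymm hi (hp0 _))
        rw [hz]
        exact mul_nonneg hJ0 (by split_ifs <;> norm_num)
  let lX : α × β → ℝ := lawOf p (fun s => (s.1, s.2.1))
  let lXC : α × β × γ → ℝ := lawOf p (fun s => (s.1, s.2.1, s.2.2.1))
  let lC : γ → ℝ := lawOf p (fun s => s.2.2.1)
  let lB : β → ℝ := lawOf p (fun s => s.2.1)
  let lBC : β × γ → ℝ := lawOf p (fun s => (s.2.1, s.2.2.1))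
  let lBCZ : β × γ × δ → ℝ := lawOf p (fun s => (s.2.1, s.2.2.1, s.2.2.2))
  have mXC : ∀ a b c, ∑ z, p (a, b, c, z) = lXC (a, b, c) := fun a b c => by
    have := sum_lawOf_fiber p (V := fun s => s) (W := fun s => (s.1, s.2.1, s.2.2.1))
      (e := fun z : δ => (a, b, c, z)) (fun _ _ h => by simpa using h) (w := (a, b, c))
      (fun s => by simp [Prod.ext_iff])
    simpa only [lawOf_id] using this
  have mX : ∀ a b, ∑ c, lXC (a, b, c) = lX (a, b) := fun a b =>
    sum_lawOf_fiber p (e := fun c : γ => (a, b, c)) (fun _ _ h => by simpa using h)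
      (fun s => by simp [Prod.ext_iff])
  have mC : ∀ c, ∑ a, ∑ b, lXC (a, b, c) = lC c := fun c => by
    have := sum_lawOf_fiber p (V := fun s => (s.1, s.2.1, s.2.2.1)) (W := fun s => s.2.2.1)
      (e := fun x : α × β => (x.1, x.2, c))
      (fun _ _ h => by simpa [Prod.ext_iff] using h) (w := c) (fun s => by simp [Prod.ext_iff])
    rwa [Fintype.sum_prod_type] at this
  have mBC : ∀ b c, ∑ a, lXC (a, b, c) = lBC (b, c) := fun b c =>
    sum_lawOf_fiber p (e := fun a : α => (a, b, c)) (fun _ _ h => by simpa using h)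
      (fun s => by simp [Prod.ext_iff])
  have mB : ∀ b, ∑ a, lX (a, b) = lB b := fun b =>
    sum_lawOf_fiber p (e := fun a : α => (a, b)) (fun _ _ h => by simpa using h)
      (fun s => by simp [Prod.ext_iff])
  have mBCZ : ∀ b c z, ∑ a, p (a, b, c, z) = lBCZ (b, c, z) := fun b c z => by
    have := sum_lawOf_fiber p (V := fun s => s) (W := fun s => (s.2.1, s.2.2.1, s.2.2.2))
      (e := fun a : α => (a, b, c, z)) (fun _ _ h => by simpa using h) (w := (b, c, z))
      (fun s => by simp [Prod.ext_iff])
    simpa only [lawOf_id] using this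
  have hTden : ∀ {a b c z}, T a b c z → ∀ (r : α × β × γ × δ → ℝ) (l : Fin 3),
      (∀ s, 0 < p s → 0 < r s) →
      letterTests p g (Sum.inl l) = (fun s => Real.logb 2 (r s)) →
      ∏ i, r (a i, b i, c i, z i) ≤ 2 ^ (n * ν (Sum.inl l)) := by
    intro a b c z hT r l hr hf
    refine prod_le_two_rpow (fun i => hr _ (hTpos hT i)) ?_
    have := hTle hT (Sum.inl l)
    rwa [hf] at this
  let PXC : (Fin n → α) → (Fin n → β) → (Fin n → γ) → ℝ := fun a b c => ∏ i, lXC (a i, b i, c i)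
  let PX : (Fin n → α) → (Fin n → β) → ℝ := fun a b => ∏ i, lX (a i, b i)
  let PC : (Fin n → γ) → ℝ := fun c => ∏ i, lC (c i)
  let PBC : (Fin n → β) → (Fin n → γ) → ℝ := fun b c => ∏ i, lBC (b i, c i)
  let PB : (Fin n → β) → ℝ := fun b => ∏ i, lB (b i)
  let PBCZ : (Fin n → β) → (Fin n → γ) → (Fin n → δ) → ℝ := fun b c z =>
    ∏ i, lBCZ (b i, c i, z i)
  have kJ : ∀ a b c z, 0 ≤ J a b c z := fun a b c z => prod_nonneg fun _ _ => hp0 _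
  have kXC : ∀ a b c, ∑ z, J a b c z = PXC a b c := fun a b c =>
    (sum_prod_apply (fun i z => p (a i, b i, c i, z))).trans (prod_congr rfl fun i _ => mXC _ _ _)
  have kX : ∀ a b, ∑ c, PXC a b c = PX a b := fun a b =>
    (sum_prod_apply (fun i c => lXC (a i, b i, c))).trans (prod_congr rfl fun i _ => mX _ _)
  have kX1 : ∑ a, ∑ b, PX a b = 1 := by
    refine (sum_pi_prod (fun s : Fin n → α × β => ∏ i, lX (s i))).symm.trans ?_
    rw [sum_prod_apply (fun (_ : Fin n) x => lX x)]
    simp [lX, sum_lawOf, hp1]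
  have kC : ∀ c, ∑ a, ∑ b, PXC a b c = PC c := fun c => by
    refine (sum_pi_prod (fun s : Fin n → α × β => ∏ i, lXC ((s i).1, (s i).2, c i))).symm.trans ?_
    rw [sum_prod_apply (fun i (x : α × β) => lXC (x.1, x.2, c i))]
    refine prod_congr rfl fun i _ => ?_
    rw [Fintype.sum_prod_type]
    exact mC _
  have kBC : ∀ b c, ∑ a, PXC a b c = PBC b c := fun b c =>
    (sum_prod_apply (fun i a => lXC (a, b i, c i))).trans (prod_congr rfl fun i _ => mBC _ _)
  have kB : ∀ b, ∑ a, PX a b = PB b := fun b =>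
    (sum_prod_apply (fun i a => lX (a, b i))).trans (prod_congr rfl fun i _ => mB _)
  have kBCZ : ∀ b c z, ∑ a, J a b c z = PBCZ b c z := fun b c z =>
    (sum_prod_apply (fun i a => p (a, b i, c i, z i))).trans (prod_congr rfl fun i _ => mBCZ _ _ _)
  have k₁ : ∀ a b c z, T a b c z →
      PXC a b c ≤ 2 ^ (n * ν (Sum.inl 0)) * (PX a b * PC c) := by
    intro a b c z hT
    have h := hTden hT (density₁ p) 0 (fun s => density₁_pos hp0) rfl
    simp only [density₁, prod_div_distrib, prod_mul_distrib] at h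
    rwa [div_le_iff₀ (mul_pos
      (prod_pos fun i _ => lawOf_pos hp0 (fun s => (s.1, s.2.1)) (hTpos hT i))
      (prod_pos fun i _ => lawOf_pos hp0 (fun s => s.2.2.1) (hTpos hT i)))] at h
  have k₂ : ∀ a b c z, T a b c z →
      2 ^ (n * -ν (Sum.inl 1)) * (PB b * PC c) ≤ PBC b c := by
    intro a b c z hT
    have h := hTden hT (density₂ p) 1 (fun s => density₂_pos hp0) rfl
    simp only [density₂, prod_div_distrib, prod_mul_distrib] at h
    rw [div_le_iff₀
      (prod_pos fun i _ => lawOf_pos hp0 (fun s => (s.2.1, s.2.2.1)) (hTpos hT i)), mul_comm (∏ i, _)] at h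
    rw [mul_neg, Real.rpow_neg zero_le_two, ← div_eq_inv_mul, div_le_iff₀ (hpos _),
      mul_comm (PB b), mul_comm (PBC b c)]
    exact h
  have k₃ : ∀ a b c z, T a b c z →
      J a b c z * PBC b c ≤ 2 ^ (n * ν (Sum.inl 2)) * (PBCZ b c z * PXC a b c) := by
    intro a b c z hT
    have h := hTden hT (density₃ p) 2 (fun s => density₃_pos hp0) rfl
    simp only [density₃, prod_div_distrib, prod_mul_distrib] at h
    rwa [div_le_iff₀ (mul_pos
      (prod_pos fun i _ => lawOf_pos hp0 (fun s => (s.2.1, s.2.2.1, s.2.2.2)) (hTpos hT i))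
      (prod_pos fun i _ => lawOf_pos hp0 (fun s => (s.1, s.2.1, s.2.2.1)) (hTpos hT i)))] at h
  obtain ⟨cw, tab, enc, hcode⟩ := exists_one_shot_code kJ kXC kX kX1 kC kBC kB kBCZ hJη (hpos _)
    (hpos _) (hpos _) k₁ k₂ k₃ hM0 hL0 hK0 hτ0 hτ1
  refine ⟨cw, tab, enc, le_trans (sum_le_sum fun a _ => sum_le_sum fun b _ => ?_) hcode⟩
  refine mul_le_mul_of_nonneg_left ?_ (prod_nonneg fun _ _ => lawOf_nonneg hp0 _ _)
  by_cases hT : T a b (cw (tab b (enc a b)).1) (tab b (enc a b)).2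
  · rw [if_pos hT]
    exact le_of_eq (if_pos fun l => hTle hT (Sum.inr l))
  · rw [if_neg hT]
    split_ifs <;> norm_num

/-- Block achievability: asymptotically reliable block codes exist at all rates above the
informations. -/
theorem eventually_exists_block_code {α β γ δ κ : Type*} [Fintype α] [Fintype β] [Fintype γ]
    [Fintype δ] [Fintype κ] {p : α × β × γ × δ → ℝ} (hp0 : ∀ s, 0 ≤ p s) (hp1 : ∑ s, p s = 1)
    (g : κ → α × β × γ × δ → ℝ) {μ : κ → ℝ} (hμ : ∀ l, ∑ s, p s * g l s < μ l) {R₁ R₂ θ : ℝ}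
    (h₁ : condMutualInfo p (fun s => s.1) (fun s => (s.2.2.1, s.2.2.2)) (fun s => s.2.1) < R₁)
    (h₂ : mutualInfo p (fun s => (s.1, s.2.1)) (fun s => s.2.2.1) < R₂) (hθ : 0 < θ) :
    ∀ᶠ n : ℕ in atTop, ∃ (cw : Fin (msgCount n R₂) → Fin n → γ)
      (tab : (Fin n → β) → Fin (msgCount n R₁) → Fin (msgCount n R₂) × (Fin n → δ))
      (enc : (Fin n → α) → (Fin n → β) → Fin (msgCount n R₁)),
      ∑ a : Fin n → α, ∑ b : Fin n → β,
        (∏ i, lawOf p (fun s => (s.1, s.2.1)) (a i, b i)) *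
        (if ∀ l, ∑ i, g l (a i, b i, cw (tab b (enc a b)).1 i, (tab b (enc a b)).2 i) ≤ n * μ l
          then 0 else 1) ≤ θ := by
  set e₁ := ∑ s, p s * Real.logb 2 (density₁ p s) with he₁
  set e₂ := ∑ s, p s * Real.logb 2 (density₂ p s) with he₂
  set e₃ := ∑ s, p s * Real.logb 2 (density₃ p s) with he₃
  have he₁0 : 0 ≤ e₁ := expect_density₁_nonneg hp0 hp1
  have he₁₂0 : 0 ≤ e₁ + e₂ := expect_density₁₂_nonneg hp0
  have he₃0 : 0 ≤ e₃ := expect_density₃_nonneg hp0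
  rw [← expect_densities_eq_condMutualInfo hp0, ← he₁, ← he₂, ← he₃] at h₁
  rw [← expect_density₁_eq_mutualInfo hp0, ← he₁] at h₂
  -- Rate budget: M, L and K have margins 2d, 4d and 2d, and one further d absorbs the rounding
  -- factors 2 for M and 4 for LK once 2^{nd} ≥ 4. This gives 3d for the second rate and 7d for the
  -- first. The test thresholds exceed the means by d, and the margin 4d of L leaves M/(B₂L) ≤
  -- 2/2^{nd}.
  obtain ⟨d, hd0, hd₁, hd₂⟩ : ∃ d > 0, e₁ + e₂ + e₃ + 7 * d ≤ R₁ ∧ e₁ + 3 * d ≤ R₂ := by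
    refine ⟨min ((R₁ - (e₁ + e₂ + e₃)) / 7) ((R₂ - e₁) / 3),
      lt_min (by linarith) (by linarith), ?_, ?_⟩
    · linarith [min_le_left ((R₁ - (e₁ + e₂ + e₃)) / 7) ((R₂ - e₁) / 3)]
    · linarith [min_le_right ((R₁ - (e₁ + e₂ + e₃)) / 7) ((R₂ - e₁) / 3)]
  obtain ⟨τ, hτ0, hτ1, hτθ⟩ : ∃ τ : ℝ, 0 < τ ∧ τ < 1 ∧ τ < θ :=
    ⟨min θ 1 / 2, by positivity, by linarith [min_le_right θ 1],
      by linarith [min_le_left θ 1, lt_min hθ one_pos]⟩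
  let ν : Fin 3 ⊕ κ → ℝ := Sum.elim ![e₁ + d, e₂ + d, e₃ + d] μ
  have hfν : ∀ l, ∑ s, p s * letterTests p g l s < ν l := by
    rintro (l | l)
    · fin_cases l
      · change e₁ < e₁ + d
        linarith
      · change e₂ < e₂ + d
        linarith
      · change e₃ < e₃ + d
        linarith
    · exact hμ l
  set η : ℕ → ℝ := fun n => ∑ s : Fin n → α × β × γ × δ, (∏ i, p (s i)) *
      (if ∀ l, ∑ i, letterTests p g l (s i) ≤ n * ν l then 0 else 1) with hη
  have hηlim : Tendsto η atTop (𝓝 0) := tendsto_prob_exceed hp0 hp1 _ hfν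
  set t : ℕ → ℝ := fun n => (2 : ℝ) ^ (n * d) with ht
  have htlim : Tendsto t atTop atTop := by
    have h : ∀ n : ℕ, t n = ((2 : ℝ) ^ d) ^ n := by
      intro n
      rw [ht, ← Real.rpow_natCast, ← Real.rpow_mul zero_le_two, mul_comm]
    simp_rw [funext h]
    exact tendsto_pow_atTop_atTop_of_one_lt (Real.one_lt_rpow one_lt_two hd0)
  have hbound : Tendsto (fun n => η n / τ + Real.exp (-(t n)) + 2 / t n +
      (τ + Real.exp (-(t n)))) atTop (𝓝 (0 / τ + 0 + 0 + (τ + 0))) := by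
    have hexp : Tendsto (fun n => Real.exp (-(t n))) atTop (𝓝 0) :=
      Real.tendsto_exp_neg_atTop_nhds_zero.comp htlim
    exact (((hηlim.div_const τ).add hexp).add (tendsto_const_nhds.div_atTop htlim)).add
      (tendsto_const_nhds.add hexp)
  have hlt : 0 / τ + 0 + 0 + (τ + 0) < θ := by simpa using hτθ
  filter_upwards [hbound.eventually (gt_mem_nhds hlt), htlim.eventually_ge_atTop 4] with n hn ht4
  -- sizes of the codebooks
  have hrp : ∀ x : ℝ, 0 ≤ x → 1 ≤ (2 : ℝ) ^ (n * x) := fun x hx =>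
    Real.one_le_rpow one_le_two (by positivity)
  have hadd : ∀ x y : ℝ, (2 : ℝ) ^ (n * (x + y)) = 2 ^ (n * x) * 2 ^ (n * y) := fun x y => by
    rw [mul_add, Real.rpow_add two_pos]
  have hpos : ∀ x : ℝ, 0 < (2 : ℝ) ^ (n * x) := fun x => Real.rpow_pos_of_pos two_pos _
  have ht0 : 0 < t n := hpos d
  set M := ⌈(2 : ℝ) ^ (n * (e₁ + 2 * d))⌉₊ with hM
  set L := ⌈(2 : ℝ) ^ (n * (e₁ + e₂ + 4 * d))⌉₊ with hL
  set K := ⌈(2 : ℝ) ^ (n * (e₃ + 2 * d))⌉₊ with hK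
  have hM0 : 0 < M := Nat.ceil_pos.2 (hpos _)
  have hL0 : 0 < L := Nat.ceil_pos.2 (hpos _)
  have hK0 : 0 < K := Nat.ceil_pos.2 (hpos _)
  have hMle : (M : ℝ) ≤ 2 * 2 ^ (n * (e₁ + 2 * d)) := nat_ceil_le_two_mul (hrp _ (by linarith))
  have hLle : (L : ℝ) ≤ 2 * 2 ^ (n * (e₁ + e₂ + 4 * d)) :=
    nat_ceil_le_two_mul (hrp _ (by linarith))
  have hKle : (K : ℝ) ≤ 2 * 2 ^ (n * (e₃ + 2 * d)) := nat_ceil_le_two_mul (hrp _ (by linarith))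
  have hMR : M ≤ msgCount n R₂ := by
    refine Nat.le_floor (hMle.trans ?_)
    calc 2 * (2 : ℝ) ^ (n * (e₁ + 2 * d)) ≤ t n * 2 ^ (n * (e₁ + 2 * d)) := by
          gcongr
          linarith
      _ = 2 ^ (n * (d + (e₁ + 2 * d))) := (hadd _ _).symm
      _ ≤ _ := by
          apply Real.rpow_le_rpow_of_exponent_le one_le_two
          gcongr
          linarith
  have hLKR : L * K ≤ msgCount n R₁ := by
    refine Nat.le_floor ?_
    push_cast
    calc (L : ℝ) * K ≤ (2 * 2 ^ (n * (e₁ + e₂ + 4 * d))) * (2 * 2 ^ (n * (e₃ + 2 * d))) := by gcongr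
      _ = 4 * (2 ^ (n * (e₁ + e₂ + 4 * d)) * 2 ^ (n * (e₃ + 2 * d))) := by ring
      _ ≤ t n * (2 ^ (n * (e₁ + e₂ + 4 * d)) * 2 ^ (n * (e₃ + 2 * d))) := by gcongr
      _ = 2 ^ (n * (d + ((e₁ + e₂ + 4 * d) + (e₃ + 2 * d)))) := by rw [hadd d, hadd (e₁ + e₂ + 4 * d) (e₃ + 2 * d)]

      _ ≤ _ := by
          apply Real.rpow_le_rpow_of_exponent_le one_le_two
          gcongr
          linarith
  obtain ⟨cw, tab, enc, hcode⟩ := exists_block_code_of_sizes hp0 hp1 g ν n hM0 hL0 hK0 hτ0 hτ1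
  change _ ≤ η n / τ + Real.exp (-(M / 2 ^ (n * (e₁ + d)))) + M / (2 ^ (n * (-(e₂ + d))) * L) +
    (τ + Real.exp (-(K / 2 ^ (n * (e₃ + d))))) at hcode
  have hB1 : Real.exp (-(M / 2 ^ (n * (e₁ + d)))) ≤ Real.exp (-(t n)) := by
    rw [Real.exp_le_exp, neg_le_neg_iff, le_div_iff₀ (hpos _)]
    refine le_trans (le_of_eq ?_) (Nat.le_ceil _)
    rw [ht, ← hadd]
    ring_nf
  have hB3 : Real.exp (-(K / 2 ^ (n * (e₃ + d)))) ≤ Real.exp (-(t n)) := by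
    rw [Real.exp_le_exp, neg_le_neg_iff, le_div_iff₀ (hpos _)]
    refine le_trans (le_of_eq ?_) (Nat.le_ceil _)
    rw [ht, ← hadd]
    ring_nf
  have hB2 : M / (2 ^ (n * (-(e₂ + d))) * L) ≤ 2 / t n := by
    have hL0' : (0 : ℝ) < L := by exact_mod_cast hL0
    rw [div_le_div_iff₀ (mul_pos (hpos _) hL0') ht0]
    calc M * t n ≤ 2 * 2 ^ (n * (e₁ + 2 * d)) * t n := by gcongr
      _ = 2 * (2 ^ (n * (-(e₂ + d))) * 2 ^ (n * (e₁ + e₂ + 4 * d))) := by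
          rw [mul_assoc, ht, ← hadd, ← hadd]
          ring_nf
      _ ≤ 2 * (2 ^ (n * (-(e₂ + d))) * L) := by
          gcongr
          exact Nat.le_ceil _
  have : Nonempty (Fin L × Fin K) := ⟨(⟨0, hL0⟩, ⟨0, hK0⟩)⟩
  obtain ⟨σ, hσ⟩ := exists_fin_surjective (κ := Fin L × Fin K) (m := msgCount n R₁)
    (by simpa using hLKR)
  -- The code uses only M of the messages; the remaining ones receive an arbitrary codeword. On the
  -- other link, a surjection onto the index pairs takes up the excess messages.
  refine ⟨fun w => if h : w.val < M then cw ⟨w.val, h⟩ else cw ⟨0, hM0⟩,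
    fun b l => (Fin.castLE hMR (tab b (σ l)).1, (tab b (σ l)).2),
    fun a b => Function.surjInv hσ (enc a b), ?_⟩
  refine le_trans (le_of_eq (sum_congr rfl fun a _ => sum_congr rfl fun b _ => ?_))
    (hcode.trans ((add_le_add (add_le_add (add_le_add le_rfl hB1) hB2)
      (add_le_add le_rfl hB3)).trans hn.le))
  simp only [Function.surjInv_eq hσ, Fin.val_castLE, Fin.is_lt, dif_pos, Fin.eta]
  rfl

end BlockCode

/-! ### Achievability for the cascade, and the two inclusions. -/

section Achievability

open scoped Classical
open Finset Filter Topology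

theorem mutualInfo_comp {Ω α β γ : Type*} [Fintype Ω] [Fintype α] [Fintype β] [Fintype γ]
    (p : Ω → ℝ) (V : Ω → α) (f : α → β) (g : α → γ) :
    mutualInfo p (fun ω => f (V ω)) (fun ω => g (V ω)) = mutualInfo (lawOf p V) f g := by
  rw [mutualInfo, mutualInfo, entropy_comp, condEntropy_comp]

theorem condMutualInfo_comp {Ω α β γ δ : Type*} [Fintype Ω] [Fintype α] [Fintype β] [Fintype γ]
    [Fintype δ] (p : Ω → ℝ) (V : Ω → α) (f : α → β) (g : α → γ) (h : α → δ) :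
    condMutualInfo p (fun ω => f (V ω)) (fun ω => g (V ω)) (fun ω => h (V ω)) =
      condMutualInfo (lawOf p V) f g h := by
  rw [condMutualInfo, condMutualInfo, condEntropy_comp,
    condEntropy_comp p V f (fun v => (g v, h v))]

theorem lawOf_comp_equiv {Ω α : Type*} [Fintype Ω] (e : Ω ≃ α) (q : α → ℝ) :
    lawOf (fun ω => q (e ω)) e = q := by
  funext a
  obtain ⟨ω, rfl⟩ := e.surjective a
  rw [lawOf_eq_sum_ite]
  simp [e.injective.eq_iff]

namespace CascadeModel

variable {X₁ X₂ Y A Xh₁ Xh₂ U : Type*} [Fintype X₁] [Fintype X₂] [Fintype Y] [Fintype A]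
  [Fintype Xh₁] [Fintype U]

/-- Rearrangement of the single-letter variables. -/
def letterEquiv (X₁ X₂ A U Xh₁ : Type*) :
    X₁ × X₂ × (U × A) × Xh₁ ≃ (X₁ × X₂) × (A × U × Xh₁) where
  toFun s := ((s.1, s.2.1), (s.2.2.1.2, s.2.2.1.1, s.2.2.2))
  invFun v := (v.1.1, v.1.2, (v.2.2.1, v.2.1), v.2.2.2)
  left_inv _ := rfl
  right_inv _ := rfl

theorem info₂₃_eq_mutualInfo (M : CascadeModel X₁ X₂ Y A Xh₁ Xh₂)
    (T : TestChannel X₁ X₂ Y A Xh₁ Xh₂ U) :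
    M.info₂₃ T = mutualInfo (fun s => M.core T.q (letterEquiv X₁ X₂ A U Xh₁ s))
      (fun s => (s.1, s.2.1)) (fun s => s.2.2.1) := by
  have h1 := mutualInfo_comp (M.joint T)
    (fun ω => ((ω.1, ω.2.1), (ω.2.2.1, ω.2.2.2.1, ω.2.2.2.2.1))) (fun v => v.1)
    (fun v => (v.2.2.1, v.2.1))
  have h2 := mutualInfo_comp (fun s => M.core T.q (letterEquiv X₁ X₂ A U Xh₁ s))
    (letterEquiv X₁ X₂ A U Xh₁) (fun v => v.1) (fun v => (v.2.2.1, v.2.1))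
  rw [lawOf_comp_equiv] at h2
  rw [lawOf_joint] at h1
  exact h1.trans h2.symm

theorem info₁₂_eq_condMutualInfo (M : CascadeModel X₁ X₂ Y A Xh₁ Xh₂)
    (T : TestChannel X₁ X₂ Y A Xh₁ Xh₂ U) :
    M.info₁₂ T = condMutualInfo (fun s => M.core T.q (letterEquiv X₁ X₂ A U Xh₁ s))
      (fun s => s.1) (fun s => (s.2.2.1, s.2.2.2)) (fun s => s.2.1) := by
  have h1 := condMutualInfo_comp (M.joint T)
    (fun ω => ((ω.1, ω.2.1), (ω.2.2.1, ω.2.2.2.1, ω.2.2.2.2.1))) (fun v => v.1.1)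
    (fun v => (v.2.2.1, v.2.1, v.2.2.2)) (fun v => v.1.2)
  have h2 := condMutualInfo_comp (fun s => M.core T.q (letterEquiv X₁ X₂ A U Xh₁ s))
    (letterEquiv X₁ X₂ A U Xh₁) (fun v => v.1.1) (fun v => (v.2.2.1, v.2.1, v.2.2.2))
    (fun v => v.1.2)
  rw [lawOf_comp_equiv] at h2
  rw [lawOf_joint] at h1
  refine h1.trans (h2.symm.trans ?_)
  rw [condMutualInfo, condMutualInfo]
  congr 1
  refine condEntropy_congr_ker (fun s => M.core_nonneg T _) (fun _ _ => Iff.rfl) fun s s' => ?_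
  simp only [letterEquiv, Equiv.coe_fn_mk, Prod.ext_iff]
  tauto

/-- Rate pairs strictly above the informations of a feasible test channel are achievable. -/
theorem achievable_of_info_lt (M : CascadeModel X₁ X₂ Y A Xh₁ Xh₂)
    (T : TestChannel X₁ X₂ Y A Xh₁ Xh₂ U) {D₁ D₂ Γ R₁ R₂ : ℝ} (hT : M.Feasible T D₁ D₂ Γ)
    (h₁ : M.info₁₂ T < R₁) (h₂ : M.info₂₃ T < R₂) : M.Achievable D₁ D₂ Γ (R₁, R₂) := by
  intro ε hε
  rw [feasible_iff] at hT
  rw [info₁₂_eq_condMutualInfo] at h₁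
  rw [info₂₃_eq_mutualInfo] at h₂
  set e := letterEquiv X₁ X₂ A U Xh₁ with he
  have hp0 : ∀ s, 0 ≤ M.core T.q (e s) := fun s => M.core_nonneg T _
  have hp1 : ∑ s, M.core T.q (e s) = 1 := by rw [e.sum_comp, M.sum_core]
  let G : Fin 3 → (X₁ × X₂) × (A × U × Xh₁) → ℝ :=
    ![fun v => M.cost v.2.1, fun v => M.dbar₁ v.1 v.2.1 v.2.2.2,
      fun v => M.dbar₂ v.1 v.2.1 (T.xhat₂ v.2.2.1)]
  let D : Fin 3 → ℝ := ![Γ, D₁, D₂]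
  have hGD : ∀ l, ∑ v, M.core T.q v * G l v ≤ D l := by
    intro l
    fin_cases l
    exacts [hT.1, hT.2.1, hT.2.2]
  have hG0 : ∀ l v, 0 ≤ G l v := by
    intro l v
    fin_cases l
    exacts [M.cost_nonneg _, M.dbar₁_nonneg _ _ _, M.dbar₂_nonneg _ _ _]
  have hD0 : ∀ l, 0 ≤ D l := fun l =>
    (sum_nonneg fun v _ => mul_nonneg (M.core_nonneg T v) (hG0 l v)).trans (hGD l)
  obtain ⟨B, hB0, hB⟩ : ∃ B : ℝ, 0 ≤ B ∧ ∀ l v, G l v ≤ B := by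
    refine ⟨∑ l, ∑ v, G l v, sum_nonneg fun l _ => sum_nonneg fun v _ => hG0 l v, fun l v => ?_⟩
    exact (single_le_sum (f := fun v => G l v) (fun v _ => hG0 l v) (mem_univ v)).trans
      (single_le_sum (f := fun l => ∑ v, G l v) (fun l _ => sum_nonneg fun v _ => hG0 l v)
        (mem_univ l))
  have hsum : ∀ l, ∑ s, M.core T.q (e s) * G l (e s) < D l + ε / 2 := fun l => by
    rw [e.sum_comp (fun v => M.core T.q v * G l v)]
    linarith [hGD l]
  -- Cost and distortions never exceed B, so failure of probability at most ε/(2(B+1)) adds at most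
  -- ε/2 to each average; the other ε/2 is the margin in the tests.
  have hev := (eventually_exists_block_code hp0 hp1 (fun l s => G l (e s)) hsum h₁ h₂
    (θ := ε / (2 * (B + 1))) (by positivity)).and (eventually_gt_atTop 0)
  rw [eventually_atTop] at hev
  obtain ⟨N, hN⟩ := hev
  refine ⟨N, fun n hn => ?_⟩
  obtain ⟨⟨cw, tab, enc, hcode⟩, hn0⟩ := hN n hn
  have hn' : (0 : ℝ) < n := by exact_mod_cast hn0
  have hlX : lawOf (fun s => M.core T.q (e s)) (fun s => (s.1, s.2.1)) = M.src := by
    have h := lawOf_comp (fun s => M.core T.q (e s)) e Prod.fst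
    rw [lawOf_comp_equiv, lawOf_core_fst] at h
    exact h
  rw [hlX] at hcode
  let c : CascadeCode X₁ X₂ Y A Xh₁ Xh₂ n R₁ R₂ :=
    { g₁ := enc
      g₂ := fun x₂ m => (tab x₂ m).1
      act := fun w i => (cw w i).2
      h₁ := fun m x₂ => (tab x₂ m).2
      h₂ := fun i w y => T.xhat₂ (cw w i).1 (y (Fin.last i.val)) }
  let V : (Fin n → X₁ × X₂) → Fin n → (X₁ × X₂) × (A × U × Xh₁) := fun ω i =>
    let l := tab (fun i => (ω i).2) (enc (fun i => (ω i).1) (fun i => (ω i).2))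
    (ω i, ((cw l.1 i).2, (cw l.1 i).1, l.2 i))
  have hfail : ∑ ω, M.blockSrc n ω * (if ∀ l, ∑ i, G l (V ω i) ≤ n * (D l + ε / 2) then 0 else 1) ≤
      ε / (2 * (B + 1)) := by
    rw [sum_pi_prod]
    refine (sum_congr rfl fun a _ => sum_congr rfl fun b _ => ?_).trans_le hcode
    refine congrArg (fun t => (∏ i, M.src (a i, b i)) * t) ?_
    split_ifs with h h' h'
    exacts [rfl, absurd h h', absurd h' h, rfl]
  have key : ∀ l, (1 / (n : ℝ)) * ∑ i, ∑ ω, M.blockSrc n ω * G l (V ω i) ≤ D l + ε := by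
    intro l
    rw [sum_comm]
    simp_rw [← mul_sum]
    have hterm : ∀ ω, M.blockSrc n ω * ∑ i, G l (V ω i) ≤
        M.blockSrc n ω * (n * (D l + ε / 2)) + n * B * (M.blockSrc n ω *
          (if ∀ l, ∑ i, G l (V ω i) ≤ n * (D l + ε / 2) then 0 else 1)) := by
      intro ω
      rw [mul_left_comm (n * B), ← mul_add]
      refine mul_le_mul_of_nonneg_left ?_ (M.blockSrc_nonneg ω)
      split_ifs with h
      · simpa using h l
      · have h3 : ∑ i, G l (V ω i) ≤ n * B := by
          refine (sum_le_sum fun i _ => hB l (V ω i)).trans (le_of_eq ?_)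
          simp
        have h4 : 0 ≤ n * (D l + ε / 2) := by
          have := hD0 l
          positivity
        linarith
    have h5 := sum_le_sum fun ω (_ : ω ∈ univ) => hterm ω
    rw [sum_add_distrib, ← sum_mul, M.sum_blockSrc, one_mul, ← mul_sum] at h5
    have h6 : B * (ε / (2 * (B + 1))) ≤ ε / 2 := by
      rw [mul_div_assoc', div_le_div_iff₀ (by positivity) two_pos]
      nlinarith
    rw [one_div, inv_mul_le_iff₀ hn']
    calc _ ≤ _ := h5
      _ ≤ n * (D l + ε / 2) + n * B * (ε / (2 * (B + 1))) := by gcongr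
      _ ≤ n * (D l + ε / 2) + n * (ε / 2) := by
          rw [mul_assoc]
          gcongr
      _ = _ := by ring
  refine ⟨c, ?_⟩
  rw [Meets, Nat.cast_one]
  refine ⟨le_trans (le_of_eq ?_) (key 0), le_trans (le_of_eq ?_) (key 1),
    le_trans (le_of_eq ?_) (key 2)⟩
  · simp_rw [expect_blockPmf_cost]
    rfl
  · simp_rw [expect_blockPmf_d₁]
    rfl
  -- The rule of Node 3 uses only the current output, so averaging over the outputs gives exactly
  -- the tested quantity `dbar₂`.
  · simp_rw [expect_blockPmf]
    congr 1
    refine sum_congr rfl fun i _ => sum_congr rfl fun ω _ => ?_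
    congr 1
    exact sum_prod_mul_apply (fun j b => M.chan (c.action (fun i => (ω i).1)
      (fun i => (ω i).2) j) (ω j).1 (ω j).2 b) (fun _ => M.sum_chan _ _ _) i
      (fun y => M.d₂ (ω i).1 (ω i).2 y (T.xhat₂ (V ω i).2.2.1 y))

/-- The region lies in the single-letter region with a bounded auxiliary alphabet. -/
theorem exists_testChannel_of_mem_region [Fintype Xh₂] (M : CascadeModel X₁ X₂ Y A Xh₁ Xh₂) {D₁ D₂ Γ : ℝ}
    {R : ℝ × ℝ} (hR : R ∈ M.region D₁ D₂ Γ) :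
    ∃ k ≤ Fintype.card X₁ * Fintype.card X₂ + 4, ∃ T : TestChannel X₁ X₂ Y A Xh₁ Xh₂ (Fin k),
      M.Feasible T D₁ D₂ Γ ∧ M.info₁₂ T ≤ R.1 ∧ M.info₂₃ T ≤ R.2 := by
  refine M.exists_testChannel_of_forall_slack _ fun ε hε => ?_
  obtain ⟨R', hR', hdist⟩ := Metric.mem_closure_iff.1 hR ε hε
  rw [Prod.dist_eq, max_lt_iff, Real.dist_eq, Real.dist_eq, abs_lt, abs_lt] at hdist
  obtain ⟨N, hN⟩ := hR' ε hε
  -- The single-letter construction needs positive length; one code suffices.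
  obtain ⟨c, hc⟩ := hN (max N 1) (le_max_left _ _)
  obtain ⟨T, hT, hT₁, hT₂⟩ :=
    M.exists_testChannel_of_code (lt_of_lt_of_le one_pos (le_max_right _ _)) c hc
  obtain ⟨k, hk, T', hT', h₁, h₂⟩ := M.exists_small_testChannel T hT
  exact ⟨k, hk, T', hT', by linarith [hdist.1.1], by linarith [hdist.2.1]⟩

/-- Every feasible test channel gives a point of the region. -/
theorem mem_region_of_testChannel (M : CascadeModel X₁ X₂ Y A Xh₁ Xh₂)
    (T : TestChannel X₁ X₂ Y A Xh₁ Xh₂ U) {D₁ D₂ Γ : ℝ} {R : ℝ × ℝ} (hT : M.Feasible T D₁ D₂ Γ)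
    (h₁ : M.info₁₂ T ≤ R.1) (h₂ : M.info₂₃ T ≤ R.2) : R ∈ M.region D₁ D₂ Γ := by
  -- Raising both rates by ε/2 makes the inequalities strict, and the closure recovers the boundary.
  refine Metric.mem_closure_iff.2 fun ε hε => ⟨(R.1 + ε / 2, R.2 + ε / 2),
    M.achievable_of_info_lt T hT (by linarith) (by linarith), ?_⟩
  rw [Prod.dist_eq, max_lt_iff, Real.dist_eq, Real.dist_eq, abs_lt, abs_lt]
  dsimp only
  refine ⟨⟨?_, ?_⟩, ?_, ?_⟩ <;> linarith

end CascadeModel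

end Achievability

/-- The rate-distortion-cost region equals the single-letter region taken over all finite
auxiliary alphabets, and also the one taken over auxiliary alphabets of size at most
`|X₁| |X₂| + 4`. -/
theorem proposition5 {X₁ X₂ Y A Xh₁ Xh₂ : Type*} [Fintype X₁] [Fintype X₂] [Fintype Y]
    [Fintype A] [Fintype Xh₁] [Fintype Xh₂] (M : CascadeModel X₁ X₂ Y A Xh₁ Xh₂)
    (D₁ D₂ Γ : ℝ) :
    M.region D₁ D₂ Γ =
      {R : ℝ × ℝ | ∃ (k : ℕ) (T : TestChannel X₁ X₂ Y A Xh₁ Xh₂ (Fin k)),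
        M.Feasible T D₁ D₂ Γ ∧ M.info₁₂ T ≤ R.1 ∧ M.info₂₃ T ≤ R.2} ∧
    M.region D₁ D₂ Γ =
      {R : ℝ × ℝ | ∃ k : ℕ, k ≤ Fintype.card X₁ * Fintype.card X₂ + 4 ∧
        ∃ T : TestChannel X₁ X₂ Y A Xh₁ Xh₂ (Fin k),
          M.Feasible T D₁ D₂ Γ ∧ M.info₁₂ T ≤ R.1 ∧ M.info₂₃ T ≤ R.2} := by
  refine ⟨Set.Subset.antisymm (fun R hR => ?_) ?_, Set.Subset.antisymm (fun R hR => ?_) ?_⟩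
  · obtain ⟨k, -, T, hT⟩ := M.exists_testChannel_of_mem_region hR
    exact ⟨k, T, hT⟩
  · rintro R ⟨k, T, hT, h₁, h₂⟩
    exact M.mem_region_of_testChannel T hT h₁ h₂
  · exact M.exists_testChannel_of_mem_region hR
  · rintro R ⟨k, -, T, hT, h₁, h₂⟩
    exact M.mem_region_of_testChannel T hT h₁ h₂
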